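/- Let $T$ be a complete first-order theory in a language $L$, and let $\mathbb{M} \models T$ be a monster model: $\mathbb{M}$ is $\kappa$-saturated for some cardinal $\kappa > |L| + \aleph_0$. Models $M \models T$ below are elementary substructures $M \preceq \mathbb{M}$ with $|M| < \kappa$; tuples of variables and parameters are finite; formulas $\varphi(x;y)$ are $L$-formulas; a set of formulas with parameters is consistent if it is finitely satisfiable. Definitions. * $\varphi(x;y)$ has SOP$_1$ if there are tuples $(a_\eta)_{\eta \in 2^{<\omega}}$ (in some model of $T$) such that $\{\varphi(x;a_{\eta|k}) : k < \omega\}$ is consistent for every $\eta \in 2^{\omega}$, and $\{\varphi(x;a_\nu), \varphi(x;a_{\eta \frown 1})\}$ is inconsistent whenever $\eta \in 2^{<\omega}$ and $\nu \unrhd \eta \frown 0$. $T$ is NSOP$_1$ if no formula has SOP$_1$. * A global type $q \in S_n(\mathbb{M})$ is $M$-invariant if $\theta(x;c) \in q \iff \theta(x;c') \in q$ for every $\theta$ and all $c, c'$ with $\operatorname{tp}(c/M) = \operatorname{tp}(c'/M)$. A Morley sequence in $q$ over $M$ is a sequence $(b_i)_{i<\omega}$ in $\mathbb{M}$ with $b_i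 \models q|_{M b_{<i}}$ for all $i$. If $q$ is $M$-invariant, $\varphi(x;y)$ $q$-divides over $M$ if $\{\varphi(x;b_i) : i < \omega\}$ is inconsistent for some (equivalently, any) Morley sequence $(b_i)_{i<\omega}$ in $q$ over $M$. * For an ultrafilter $\mathcal{D}$ on $M^n$ and $A \subseteq \mathbb{M}$, $\operatorname{Av}(\mathcal{D},A)$ is the set of formulas $\theta(y;a)$ with $a$ a tuple from $A$ and $\{b \in M^n : \mathbb{M} \models \theta(b;a)\} \in \mathcal{D}$. With $n$ the length of $y$, $(\varphi(x;y), M, \mathcal{D})$ is a higher formula if $\{\varphi(x;b_i) : i < \omega\}$ is consistent for every Morley sequence $(b_i)_{i<\omega}$ over $M$ in the global type $\operatorname{Av}(\mathcal{D},\mathbb{M})$. Theorem. The following are equivalent. 1. $T$ is NSOP$_1$. 2. (Ultrafilter independence of higher formulas) For every model $M \models T$, every formula $\varphi(x;y)$, and all ultrafilters $\mathcal{D}$, $\mathcal{E}$ on $M^{l(y)}$, where $l(y)$ is the length of $y$, with $\operatorname{Av}(\mathcal{D},M) = \operatorname{Av}(\mathcal{E},M)$: $(\varphi,M,\mathcal{D})$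 is a higher formula if and only if $(\varphi,M,\mathcal{E})$ is. 3. (Kim's lemma for Kim-dividing) For every model $M \models T$, every formula $\varphi(x;y)$ and every tuple $b$ in $\mathbb{M}$ of the length of $y$: if $\varphi(x;y)$ $q$-divides over $M$ for some global $M$-invariant type $q \supseteq \operatorname{tp}(b/M)$, then $\varphi(x;y)$ $q$-divides over $M$ for every global $M$-invariant type $q \supseteq \operatorname{tp}(b/M)$. -/

import Mathlib

/-!
`(1) → (3)`: Let `q` and `r` be `A`-invariant extensions of the same type over `A` such that `φ`
`q`-divides but does not `r`-divide. Take `l` maximal such that `φ` is consistent along `l`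
realizations of `q` over arbitrarily long Morley sequences in `r`, so that `l + 1` realizations of
`q` over some finite Morley sequence in `r` already make it inconsistent. Finite binary trees whose
nodes carry blocks of Morley tuples in `r` are built from the leaves: the right subtree of a new
root is a copy of the left one whose first tuple realizes `q` over the left one, and the block at
the root is a Morley sequence in `r` over both. The conjunction of `φ` over a block and over `l`
realizations of `q` over the tree is consistent along paths, and inconsistent across a splitting
into left and right. Compactness gives SOP₁.

`(3) → (2)`: The average type of `D` is `M`-invariant, and `φ` divides in it exactly when
`(φ, M, D)` is not a higher formula.

`(2) → (1)`: In an SOP₁ tree, the pigeonhole principle produces arrays with two columns: `φ` is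
consistent along the left one, its instances along the right one are pairwise inconsistent, and both
columns agree on finitely many formulas with parameters in the Skolem hull of the previous rows. In
an ultraproduct of such arrays, the two columns have the same limit type over the Skolem hull `M`.
Ultrafilters concentrated on the two columns contradict ultrafilter independence.
-/

open FirstOrder

universe u v w

namespace KimDividing



section Basic

variable {L : FirstOrder.Language.{u, v}} {N : Type w} [L.Structure N]

/-- The set of formulas `{φ(x; b i) : i ∈ ι}` is consistent: each of its finite subsets has a
solution in the ambient structure `N`. -/
def Consistent {ι : Type*} {m n : ℕ} (φ : L.Formula (Fin m ⊕ Fin n)) (b : ι → Fin n → N) : Prop :=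
  ∀ s : Finset ι, ∃ a : Fin m → N, ∀ i ∈ s, φ.Realize (Sum.elim a (b i))

/-- `φ(x; y)` has SOP₁ in `N`. Nodes of `2^{<ω}` are lists of Booleans (`false` is `0`, `true` is
`1`), extended by appending at the end; `<+:` is the tree order. -/
def FormulaSOP1 (N : Type w) [L.Structure N] {m n : ℕ} (φ : L.Formula (Fin m ⊕ Fin n)) : Prop :=
  ∃ a : List Bool → Fin n → N,
    (∀ η : ℕ → Bool, Consistent φ (fun k : ℕ => a ((List.range k).map η))) ∧
    (∀ η ν : List Bool, (η ++ [false]) <+: ν → ¬ Consistent φ ![a ν, a (η ++ [true])])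

/-- `T` has SOP₁: some formula has SOP₁ in some model of `T`. -/
def SOP1 (T : L.Theory) : Prop :=
  ∃ (N : FirstOrder.Language.Theory.ModelType.{u, v, max u v} T) (m n : ℕ)
    (φ : L.Formula (Fin m ⊕ Fin n)), FormulaSOP1 N φ

/-- `T` is NSOP₁. -/
def NSOP1 (T : L.Theory) : Prop := ¬ SOP1 T

/-- The formula with parameters `θ(x; a)`, as a formula in the language with constants for the
elements of `N`. -/
noncomputable def inst {n k : ℕ} (θ : L.Formula (Fin n ⊕ Fin k)) (a : Fin k → N) :
    L[[N]].Formula (Fin n) :=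
  FirstOrder.Language.BoundedFormula.constantsVarsEquiv.symm
    (θ.relabel (Sum.elim Sum.inr (Sum.inl ∘ a) : Fin n ⊕ Fin k → N ⊕ Fin n))

theorem realize_inst {n k : ℕ} (θ : L.Formula (Fin n ⊕ Fin k)) (a : Fin k → N) (v : Fin n → N) :
    (inst θ a).Realize v ↔ θ.Realize (Sum.elim v a) := by
  unfold inst FirstOrder.Language.Formula.Realize
  rw [← FirstOrder.Language.BoundedFormula.realize_constantsVarsEquiv, Equiv.apply_symm_apply]
  refine (FirstOrder.Language.Formula.realize_relabel (φ := θ)).trans ?_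
  unfold FirstOrder.Language.Formula.Realize
  rw [iff_iff_eq]
  congr 1
  funext x
  rcases x with i | j
  · simp
  · rfl

/-- The formulas `θ(x; a)`, `x` of length `n`, with parameters `a` from `A`. -/
def formulasOver (n : ℕ) (A : Set N) : Set (L[[N]].Formula (Fin n)) :=
  {ψ | ∃ (k : ℕ) (θ : L.Formula (Fin n ⊕ Fin k)) (a : Fin k → N), (∀ i, a i ∈ A) ∧ ψ = inst θ a}

/-- The tuple `b` realizes the set of formulas `p`. -/
def Realizes {n : ℕ} (b : Fin n → N) (p : Set (L[[N]].Formula (Fin n))) : Prop :=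
  ∀ ψ ∈ p, ψ.Realize b

variable (L) in
/-- The type `tp(b/A)`. -/
def tp {n : ℕ} (b : Fin n → N) (A : Set N) : Set (L[[N]].Formula (Fin n)) :=
  {ψ ∈ formulasOver n A | ψ.Realize b}

variable (L) in
/-- `N` is `κ`-saturated: every finitely satisfiable set of formulas, in finitely many variables,
over fewer than `κ` parameters is realized in `N`. -/
def IsSaturated (κ : Cardinal.{w}) (N : Type w) [L.Structure N] : Prop :=
  ∀ (A : Set N), Cardinal.mk A < κ → ∀ (n : ℕ) (p : Set (L[[N]].Formula (Fin n))),
    p ⊆ formulasOver n A →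
    (∀ s : Finset (L[[N]].Formula (Fin n)), (s : Set (L[[N]].Formula (Fin n))) ⊆ p →
      ∃ b : Fin n → N, Realizes b (s : Set (L[[N]].Formula (Fin n)))) →
    ∃ b : Fin n → N, Realizes b p

variable (L) in
/-- Global types in `n` variables: complete types over `N`, that is, complete types of the
elementary diagram of `N`. -/
abbrev GlobalType (N : Type w) [L.Structure N] (n : ℕ) :=
  (L.elementaryDiagram N).CompleteType (Fin n)

/-- The set of formulas over `N` that belong to a global type. -/
def GlobalType.formulas {n : ℕ} (q : GlobalType L N n) : Set (L[[N]].Formula (Fin n)) :=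
  {ψ | FirstOrder.Language.Formula.equivSentence ψ ∈ q}

/-- `q` is `A`-invariant: `c ≡_A c'` implies `θ(x; c) ∈ q ↔ θ(x; c') ∈ q`. -/
def GlobalType.IsInvariant {n : ℕ} (q : GlobalType L N n) (A : Set N) : Prop :=
  ∀ (k : ℕ) (θ : L.Formula (Fin n ⊕ Fin k)) (c c' : Fin k → N),
    tp L c A = tp L c' A → (inst θ c ∈ q.formulas ↔ inst θ c' ∈ q.formulas)

/-- The average type `Av(D, A)` of an ultrafilter `D` on a set `I` of `n`-tuples. -/
def average {n : ℕ} {I : Set (Fin n → N)} (D : Ultrafilter I) (A : Set N) :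
    Set (L[[N]].Formula (Fin n)) :=
  {ψ ∈ formulasOver n A | {b : I | ψ.Realize (b : Fin n → N)} ∈ D}

/-- The set `A^n` of `n`-tuples from `A`. -/
def tuples (n : ℕ) (A : Set N) : Set (Fin n → N) := {c | ∀ i, c i ∈ A}

/-- The set `A b_{<i}`: `A` together with the entries of the tuples `b j`, `j < i`. -/
def below {n : ℕ} (A : Set N) (b : ℕ → Fin n → N) (i : ℕ) : Set N :=
  A ∪ {c | ∃ j < i, ∃ t : Fin n, c = b j t}

/-- `(b i)_{i < ω}` is a Morley sequence over `A` in the global type with set of formulas `q`: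
each `b i` realizes the restriction of `q` to `A b_{<i}`. -/
def IsMorleySequence {n : ℕ} (q : Set (L[[N]].Formula (Fin n))) (A : Set N)
    (b : ℕ → Fin n → N) : Prop :=
  ∀ i, Realizes (b i) (q ∩ formulasOver n (below A b i))

/-- `φ(x; y)` `q`-divides over `A`. -/
def QDivides {m n : ℕ} (φ : L.Formula (Fin m ⊕ Fin n)) (q : GlobalType L N n) (A : Set N) : Prop :=
  ∃ b : ℕ → Fin n → N, IsMorleySequence q.formulas A b ∧ ¬ Consistent φ b

/-- `(φ, A, D)` is a higher formula: with `q = Av(D, N)`, the instances of `φ` along Morley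
sequences in `q` over `A` are consistent. -/
def IsHigher {m n : ℕ} (φ : L.Formula (Fin m ⊕ Fin n)) (A : Set N)
    (D : Ultrafilter (tuples n A)) : Prop :=
  ∀ b : ℕ → Fin n → N, IsMorleySequence (average (L := L) D Set.univ) A b → Consistent φ b

end Basic

end KimDividing

universe z

namespace KimDividing

open FirstOrder.Language

section SameType

variable {L : FirstOrder.Language.{u, v}} {ι ι' β P Q R : Type*} [L.Structure P] [L.Structure Q]
  [L.Structure R]

/-- The tuples `x` and `y`, possibly in different structures, satisfy the same formulas. -/
def SameType (L : FirstOrder.Language.{u, v}) {ι P Q : Type*} [L.Structure P] [L.Structure Q]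
    (x : ι → P) (y : ι → Q) : Prop :=
  ∀ θ : L.Formula ι, θ.Realize x ↔ θ.Realize y

theorem SameType.symm {x : ι → P} {y : ι → Q} (h : SameType L x y) : SameType L y x :=
  fun θ => (h θ).symm

theorem SameType.trans {x : ι → P} {y : ι → Q} {z : ι → R} (h : SameType L x y)
    (h' : SameType L y z) : SameType L x z :=
  fun θ => (h θ).trans (h' θ)

theorem SameType.comp {x : ι → P} {y : ι → Q} (h : SameType L x y) (f : ι' → ι) :
    SameType L (x ∘ f) (y ∘ f) := fun θ => by
  simpa only [Formula.realize_relabel] using h (θ.relabel f)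

theorem SameType.reindex {x : ι → P} {y : ι → Q} (h : SameType L x y) (f : ι' → ι) {x' : ι' → P}
    {y' : ι' → Q} (hx : ∀ i, x (f i) = x' i := by simp) (hy : ∀ i, y (f i) = y' i := by simp) :
    SameType L x' y' :=
  funext hx ▸ funext hy ▸ h.comp f

theorem SameType.of_imp {x : ι → P} {y : ι → Q}
    (h : ∀ θ : L.Formula ι, θ.Realize x → θ.Realize y) : SameType L x y := fun θ =>
  ⟨h θ, not_imp_not.1 fun hx => Formula.realize_not.1 (h θ.not (Formula.realize_not.2 hx))⟩

theorem SameType.eq_of_eq {x : ι → P} {y : ι → Q} (h : SameType L x y) {i j : ι}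
    (hij : x i = x j) : y i = y j := by
  simpa [Formula.realize_equal, hij] using h ((Term.var i).equal (Term.var j))

theorem sameType_elementaryEmbedding (g : P ↪ₑ[L] Q) (x : ι → P) : SameType L x (g ∘ x) :=
  fun θ => (g.map_formula θ x).symm

theorem realize_relabel_map_id {ι' : Type*} (φ : L.Formula (β ⊕ ι')) (s : ι' → ι) (b : β → P)
    (x : ι → P) : (φ.relabel (Sum.map id s)).Realize (Sum.elim b x) ↔
      φ.Realize (Sum.elim b (x ∘ s)) := by
  rw [Formula.realize_relabel, Sum.elim_comp_map, Function.comp_id]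

theorem SameType.of_forall_fin {b : β → P} {c : β → Q} {x : ι → P} {y : ι → Q}
    (h : ∀ (k : ℕ) (s : Fin k → ι), SameType L (Sum.elim b (x ∘ s)) (Sum.elim c (y ∘ s))) :
    SameType L (Sum.elim b x) (Sum.elim c y) := fun θ => by
  classical
  let e := θ.freeVarFinset.toRight.equivFin
  let s : Fin _ → ι := fun i => e.symm i
  let f : θ.freeVarFinset → β ⊕ Fin _ := fun
    | ⟨.inl a, _⟩ => .inl a
    | ⟨.inr i, hi⟩ => .inr (e ⟨i, Finset.mem_toRight.2 hi⟩)
  let θ' : L.Formula (β ⊕ Fin _) := θ.restrictFreeVar f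
  have hx : θ'.Realize (Sum.elim b (x ∘ s)) ↔ θ.Realize (Sum.elim b x) :=
    BoundedFormula.realize_restrictFreeVar _ (by rintro ⟨_ | _, _⟩ <;> simp [f, s])
  have hy : θ'.Realize (Sum.elim c (y ∘ s)) ↔ θ.Realize (Sum.elim c y) :=
    BoundedFormula.realize_restrictFreeVar _ (by rintro ⟨_ | _, _⟩ <;> simp [f, s])
  rw [← hx, ← hy]
  exact h _ _ _

theorem SameType.exists_iff {τ : Type*} [Finite β] [Finite τ] {x : ι → P} {y : ι → Q}
    (h : SameType L x y) (φ : τ → L.Formula (β ⊕ ι)) :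
    (∃ a : β → P, ∀ i, (φ i).Realize (Sum.elim a x)) ↔
      ∃ a : β → Q, ∀ i, (φ i).Realize (Sum.elim a y) := by
  simpa [Formula.realize_iExs, Formula.realize_iInf, Formula.realize_relabel] using
    h (Formula.iExs β (Formula.iInf fun i => (φ i).relabel Sum.swap))

end SameType

section SameTypeOver

variable {L : FirstOrder.Language.{u, v}} {N : Type w} [L.Structure N]

/-- The tuples `x` and `y` have the same type over `A`, written `x ≡_A y`. -/
def SameTypeOver (L : FirstOrder.Language.{u, v}) {N : Type w} [L.Structure N] (A : Set N)
    {ι : Type*} (x y : ι → N) : Prop :=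
  SameType L (Sum.elim x ((↑) : A → N)) (Sum.elim y ((↑) : A → N))

theorem tp_eq_tp_iff {k : ℕ} {A : Set N} {c c' : Fin k → N} :
    tp L c A = tp L c' A ↔ SameTypeOver L A c c' := by
  constructor
  · intro h
    refine SameType.of_forall_fin fun l s => SameType.of_imp fun θ hθ => ?_
    have hmem : inst θ ((↑) ∘ s) ∈ tp L c A :=
      ⟨⟨l, θ, _, fun i => (s i).2, rfl⟩, (realize_inst _ _ _).2 hθ⟩
    exact (realize_inst _ _ _).1 (h ▸ hmem).2
  · intro h
    ext ψ
    refine and_congr_right ?_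
    rintro ⟨l, θ, a, ha, rfl⟩
    rw [realize_inst, realize_inst]
    exact h.reindex (Sum.map id fun i => (⟨a i, ha i⟩ : A)) (x' := Sum.elim c a)
      (y' := Sum.elim c' a) (by simp) (by simp) θ

end SameTypeOver

section Saturation

variable {L : FirstOrder.Language.{u, v}} {N : Type w} [L.Structure N] {κ : Cardinal.{w}}
  {ι P : Type*} {τ : Type z} [L.Structure P] {x : ι → P} {y : ι → N} {a : τ → P}

theorem IsSaturated.exists_tuple (hN : IsSaturated L κ N) (hxy : SameType L x y)
    (hy : Cardinal.mk (Set.range y) < κ) {n : ℕ} (a : Fin n → P) :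
    ∃ b : Fin n → N, SameType L (Sum.elim a x) (Sum.elim b y) := by
  let p : Set (L[[N]].Formula (Fin n)) := {ψ | ∃ (k : ℕ) (θ : L.Formula (Fin n ⊕ Fin k))
    (s : Fin k → ι), θ.Realize (Sum.elim a (x ∘ s)) ∧ ψ = inst θ (y ∘ s)}
  have hpy : p ⊆ formulasOver n (Set.range y) := by
    rintro _ ⟨k, θ, s, -, rfl⟩
    exact ⟨k, θ, y ∘ s, fun i => ⟨s i, rfl⟩, rfl⟩
  have finitely_satisfiable (F : Finset (L[[N]].Formula (Fin n))) (hF : ↑F ⊆ p) :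
      ∃ b : Fin n → N, Realizes b (F : Set (L[[N]].Formula (Fin n))) := by
    choose k θ s hθ hψ using fun ψ : F => hF ψ.2
    obtain ⟨b, hb⟩ := (hxy.exists_iff fun ψ : F => (θ ψ).relabel (Sum.map id (s ψ))).1
      ⟨a, fun ψ => (realize_relabel_map_id _ _ _ _).2 (hθ ψ)⟩
    refine ⟨b, fun ψ hψF => ?_⟩
    rw [show ψ = _ from hψ ⟨ψ, hψF⟩, realize_inst]
    exact (realize_relabel_map_id _ _ _ _).1 (hb _)
  obtain ⟨b, hb⟩ := hN (Set.range y) hy n p hpy finitely_satisfiable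
  exact ⟨b, SameType.of_forall_fin fun k s => SameType.of_imp fun θ hθ =>
    (realize_inst _ _ _).1 (hb _ ⟨k, θ, s, hθ, rfl⟩)⟩

/-- A partial copy in `N`, over the correspondence of `x` with `y`, of the family `a`: the set of
pairs `G` relates indices of `a` to elements of `N` that realize the same formulas. -/
def IsPartialCopy (L : FirstOrder.Language.{u, v}) {N : Type w} [L.Structure N] {ι P : Type*}
    {τ : Type z} [L.Structure P] (x : ι → P) (y : ι → N) (a : τ → P) (G : Set (τ × N)) : Prop :=
  SameType L (Sum.elim x fun g : G => a g.1.1) (Sum.elim y fun g : G => g.1.2)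

theorem SameType.isPartialCopy_empty (hxy : SameType L x y) (a : τ → P) :
    IsPartialCopy L x y a ∅ :=
  hxy.reindex (Sum.elim id fun g : (∅ : Set (τ × N)) => g.2.elim)

theorem isPartialCopy_sUnion {c : Set (Set (τ × N))} (hc : ∀ G ∈ c, IsPartialCopy L x y a G)
    (hchain : IsChain (· ⊆ ·) c) (hne : c.Nonempty) : IsPartialCopy L x y a (⋃₀ c) := by
  classical
  refine SameType.of_forall_fin fun k s => ?_
  obtain ⟨G, hGc, hG⟩ := DirectedOn.exists_mem_subset_of_finset_subset_biUnion (f := id) hne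
    hchain.directedOn (s := Finset.univ.image fun i => (s i).1) (by
      simpa [Set.range_subset_iff] using fun i => Set.mem_sUnion.1 (s i).2)
  have hG' (i : Fin k) : (s i).1 ∈ G := hG (by simp)
  exact (hc G hGc).reindex (Sum.map id fun i : Fin k => (⟨(s i).1, hG' i⟩ : G))

theorem IsPartialCopy.mk_range_lt {G : Set (τ × N)} (hG : IsPartialCopy L x y a G)
    (hκ : Cardinal.aleph0 < κ) (hy : Cardinal.mk (Set.range y) < κ)
    (hτ : Cardinal.lift.{w} (Cardinal.mk τ) < Cardinal.lift.{z} κ) :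
    Cardinal.mk (Set.range (Sum.elim y fun g : G => g.1.2)) < κ := by
  rw [Set.Sum.elim_range]
  refine (Cardinal.mk_union_le _ _).trans_lt (Cardinal.add_lt_of_lt hκ.le hy ?_)
  have functional {i c c'} (hc : (i, c) ∈ G) (hc' : (i, c') ∈ G) : c = c' :=
    hG.eq_of_eq (i := Sum.inr ⟨_, hc⟩) (j := Sum.inr ⟨_, hc'⟩) rfl
  have hindex (c : Set.range fun g : G => g.1.2) : ∃ i, (i, c.1) ∈ G := by
    obtain ⟨g, hg⟩ := c.2
    exact ⟨g.1.1, hg ▸ g.2⟩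
  choose index hindex using hindex
  have index_injective : Function.Injective index := fun c c' hcc' =>
    Subtype.ext (functional (hindex c) (hcc' ▸ hindex c'))
  exact Cardinal.lift_lt.1 ((Cardinal.lift_mk_le_lift_mk_of_injective index_injective).trans_lt hτ)

theorem IsPartialCopy.exists_insert {G : Set (τ × N)} (hG : IsPartialCopy L x y a G)
    (hN : IsSaturated L κ N) (hcard : Cardinal.mk (Set.range (Sum.elim y fun g : G => g.1.2)) < κ)
    (i : τ) : ∃ c, IsPartialCopy L x y a (insert (i, c) G) := by
  classical
  obtain ⟨b, hb⟩ := hN.exists_tuple hG hcard fun _ : Fin 1 => a i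
  let f (g : ↥(insert (i, b 0) G)) : Fin 1 ⊕ ι ⊕ G :=
    if hg : g.1 = (i, b 0) then Sum.inl 0 else Sum.inr (Sum.inr ⟨g.1, g.2.resolve_left hg⟩)
  refine ⟨b 0, hb.reindex (Sum.elim (Sum.inr ∘ Sum.inl) f) ?_ ?_⟩ <;>
  · rintro (z | z)
    · rfl
    · by_cases hg : z.1 = (i, b 0) <;> simp [f, hg]

theorem IsSaturated.exists_family (hN : IsSaturated L κ N) (hκ : Cardinal.aleph0 < κ)
    (hxy : SameType L x y) (hy : Cardinal.mk (Set.range y) < κ) (a : τ → P)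
    (hτ : Cardinal.lift.{w} (Cardinal.mk τ) < Cardinal.lift.{z} κ) :
    ∃ b : τ → N, SameType L (Sum.elim a x) (Sum.elim b y) := by
  obtain ⟨G, -, hG⟩ := zorn_subset_nonempty {G | IsPartialCopy L x y a G}
    (fun c hc hchain hne => ⟨⋃₀ c, isPartialCopy_sUnion hc hchain hne,
      fun _ => Set.subset_sUnion_of_mem⟩) ∅ (hxy.isPartialCopy_empty a)
  have total (i : τ) : ∃ c, (i, c) ∈ G := by
    obtain ⟨c, hc⟩ := hG.prop.exists_insert hN (hG.prop.mk_range_lt hκ hy hτ) i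
    exact ⟨c, hG.le_of_ge hc (Set.subset_insert _ _) (Set.mem_insert _ _)⟩
  choose b hb using total
  exact ⟨b, hG.prop.reindex (Sum.elim (fun i => Sum.inr ⟨(i, b i), hb i⟩) Sum.inl)⟩

theorem sameType_of_isEmpty [IsEmpty ι] (h : P ≅[L] N) (x : ι → P) (y : ι → N) :
    SameType L x y := fun θ => by
  have hx : x = default ∘ (isEmptyElim : ι → Empty) := Subsingleton.elim _ _
  have hy : y = default ∘ (isEmptyElim : ι → Empty) := Subsingleton.elim _ _
  rw [hx, hy, ← Formula.realize_relabel, ← Formula.realize_relabel]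
  exact h.realize_sentence _

theorem IsSaturated.exists_elementaryEmbedding {M : Type z} [L.Structure M]
    (hN : IsSaturated L κ N) (hκ : Cardinal.aleph0 < κ) (h : M ≅[L] N)
    (hM : Cardinal.lift.{w} (Cardinal.mk M) < Cardinal.lift.{z} κ) : Nonempty (M ↪ₑ[L] N) := by
  obtain ⟨f, hf⟩ := hN.exists_family hκ
    (sameType_of_isEmpty h (isEmptyElim : Empty → M) isEmptyElim)
    (by rw [Set.range_eq_empty, Cardinal.mk_eq_zero]; exact Cardinal.aleph0_pos.trans hκ)
    id hM
  exact ⟨⟨f, fun k φ x => ((hf.reindex (Sum.inl ∘ x) : SameType L x (f ∘ x)) φ).symm⟩⟩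

end Saturation

section Realization

variable {L : FirstOrder.Language.{u, v}} {N : Type w} {n : ℕ}

theorem formulasOver_mono {A B : Set N} (h : A ⊆ B) :
    formulasOver (L := L) n A ⊆ formulasOver n B := by
  rintro _ ⟨k, θ, a, ha, rfl⟩
  exact ⟨k, θ, a, fun i => h (ha i), rfl⟩

theorem realize_inst_of_isExpansionOn {P : Type*} [L.Structure P] [L[[N]].Structure P]
    [(L.lhomWithConstants N).IsExpansionOn P] {k : ℕ} (θ : L.Formula (Fin n ⊕ Fin k))
    (a : Fin k → N) (e : Fin n → P) :
    (inst θ a).Realize e ↔ θ.Realize (Sum.elim e fun i => (L.con (a i) : P)) := by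
  unfold inst Formula.Realize
  rw [← BoundedFormula.realize_constantsVarsEquiv, Equiv.apply_symm_apply]
  refine (Formula.realize_relabel (φ := θ)).trans (iff_of_eq (congrArg θ.Realize ?_))
  ext (_ | _) <;> rfl

variable [L.Structure N]

/-- The tuple `c` realizes the restriction of `q` to `A`. -/
def GlobalType.IsRealizedOver (q : GlobalType L N n) (A : Set N) (c : Fin n → N) : Prop :=
  Realizes c (q.formulas ∩ formulasOver n A)

theorem GlobalType.IsRealizedOver.mono {q : GlobalType L N n} {A B : Set N} {c : Fin n → N}
    (h : q.IsRealizedOver B c) (hAB : A ⊆ B) : q.IsRealizedOver A c :=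
  fun ψ hψ => h ψ ⟨hψ.1, formulasOver_mono hAB hψ.2⟩

/-- The tuple `d` of the elementary extension `P` of `N` realizes the global type `q`. -/
def IsRealization (q : GlobalType L N n) {P : Type*} [L.Structure P] (j : N ↪ₑ[L] P)
    (d : Fin n → P) : Prop :=
  ∀ (k : ℕ) (θ : L.Formula (Fin n ⊕ Fin k)) (a : Fin k → N),
    inst θ a ∈ q.formulas ↔ θ.Realize (Sum.elim d (j ∘ a))

theorem GlobalType.exists_isRealization (q : GlobalType L N n) :
    ∃ (P : Type (max u v w)) (_ : L.Structure P) (j : N ↪ₑ[L] P) (d : Fin n → P),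
      IsRealization q j d := by
  obtain ⟨P, d, rfl⟩ := Theory.exists_modelType_is_realized_in _ q
  let _ : L.Structure P := (L.lhomWithConstants N).reduct P
  have _ : (L.lhomWithConstants N).IsExpansionOn P := LHom.isExpansionOn_reduct _ _
  exact ⟨P, inferInstance, ElementaryEmbedding.ofModelsElementaryDiagram L N P, d, fun k θ a =>
    (Theory.CompleteType.formula_mem_typeOf (T := L.elementaryDiagram N)).trans
      (realize_inst_of_isExpansionOn θ a d)⟩

variable {q : GlobalType L N n} {A : Set N} {ι : Type*} {x y : ι → N} {c c' : Fin n → N}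

section

variable {P : Type*} [L.Structure P] {j : N ↪ₑ[L] P} {d : Fin n → P}

theorem IsRealization.isRealizedOver_range_iff (hq : IsRealization q j d) :
    q.IsRealizedOver (Set.range x) c ↔ SameType L (Sum.elim d (j ∘ x)) (Sum.elim c x) := by
  constructor
  · exact fun hc => SameType.of_forall_fin fun k s => SameType.of_imp fun θ hθ =>
      (realize_inst _ _ _).1 (hc _ ⟨(hq k θ (x ∘ s)).2 hθ, k, θ, x ∘ s, fun i => ⟨s i, rfl⟩, rfl⟩)
  · rintro h _ ⟨hψ, k, θ, a, ha, rfl⟩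
    choose s hs using ha
    obtain rfl : x ∘ s = a := funext hs
    exact (realize_inst _ _ _).2
      ((h.reindex (Sum.map id s) (by simp) (by simp) θ).1 ((hq k θ _).1 hψ))

theorem IsRealization.sameType_of_isInvariant (hq : IsRealization q j d) (hinv : q.IsInvariant A)
    (hxy : SameTypeOver L A x y) : SameType L (Sum.elim d (j ∘ x)) (Sum.elim d (j ∘ y)) :=
  SameType.of_forall_fin fun k s => SameType.of_imp fun θ hθ =>
    (hq k θ _).1 ((hinv k θ _ _ (tp_eq_tp_iff.2 (hxy.reindex (Sum.map s id)))).1 ((hq k θ _).2 hθ))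

end

theorem GlobalType.exists_isRealizedOver {κ : Cardinal.{w}} (hN : IsSaturated L κ N)
    (q : GlobalType L N n) (hA : Cardinal.mk A < κ) : ∃ c, q.IsRealizedOver A c := by
  obtain ⟨P, _, j, d, hq⟩ := q.exists_isRealization
  obtain ⟨c, hc⟩ := hN.exists_tuple (sameType_elementaryEmbedding j ((↑) : A → N)).symm
    (by rwa [Subtype.range_coe]) d
  exact ⟨c, by simpa using hq.isRealizedOver_range_iff.2 hc⟩

theorem GlobalType.isRealizedOver_iff_sameTypeOver (hinv : q.IsInvariant A)
    (hxy : SameTypeOver L A x y) (hc : q.IsRealizedOver (A ∪ Set.range x) c) :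
    q.IsRealizedOver (A ∪ Set.range y) c' ↔ SameTypeOver L A (Sum.elim c x) (Sum.elim c' y) := by
  obtain ⟨P, _, j, d, hq⟩ := q.exists_isRealization
  have range_eq (x : ι → N) : A ∪ Set.range x = Set.range (Sum.elim x ((↑) : A → N)) := by
    rw [Set.Sum.elim_range, Subtype.range_coe, Set.union_comm]
  rw [range_eq, hq.isRealizedOver_range_iff] at hc ⊢
  have h := hc.symm.trans (hq.sameType_of_isInvariant (A := A) hinv
    (x := Sum.elim x ((↑) : A → N)) (y := Sum.elim y ((↑) : A → N))
    (hxy.reindex (Sum.elim id Sum.inr)))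
  exact ⟨fun hc' => (h.trans hc').reindex (Equiv.sumAssoc _ _ _),
    fun hc' => h.symm.trans (hc'.reindex (Equiv.sumAssoc _ _ _).symm)⟩

end Realization

section Sequence

theorem exists_seq_of_forall_list {X : Type*} {P : List X → X → Prop} (h : ∀ l, ∃ x, P l x) :
    ∃ f : ℕ → X, ∀ i, P ((List.range i).map f) (f i) := by
  choose g hg using h
  let l : ℕ → List X := Nat.rec [] fun _ l => l ++ [g l]
  have hl (i : ℕ) : (List.range i).map (fun j => g (l j)) = l i := by
    induction i with
    | zero => rfl
    | succ i ih => rw [List.range_succ, List.map_append, ih]; rfl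
  exact ⟨fun i => g (l i), fun i => by rw [hl]; exact hg _⟩

end Sequence

section MorleyList

variable {α β : Type*} {n : ℕ}

/-- The set of entries of the tuples in a list. -/
def entries (l : List (Fin n → α)) : Set α := ⋃ c ∈ l, Set.range c

theorem entries_cons (c : Fin n → α) (l : List (Fin n → α)) :
    entries (c :: l) = Set.range c ∪ entries l := by
  simp [entries, Set.iUnion_or, Set.iUnion_union_distrib]

theorem entries_subset_of_subset {l l' : List (Fin n → α)} (h : l ⊆ l') :
    entries l ⊆ entries l' :=
  Set.biUnion_subset_biUnion_left h

theorem entries_map (x : α → β) (s : List (Fin n → α)) :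
    entries (s.map (x ∘ ·)) = Set.range fun i : entries s => x i := by
  simp [entries, Set.range_comp, Set.image_iUnion, ← Set.image_eq_range]

theorem finite_entries (l : List (Fin n → α)) : (entries l).Finite :=
  l.finite_toSet.biUnion fun _ _ => Set.finite_range _

variable {L : FirstOrder.Language.{u, v}} {N : Type w} [L.Structure N] {A : Set N}
  {ps ps' : List (GlobalType L N n)} {l l' : List (Fin n → N)} {κ : Cardinal.{w}}

/-- `IsMorleyList A ps l`: each tuple of `l` realizes the corresponding type of `ps` over `A` and
the tuples further down the list. In particular, the head of the list is realized last. -/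
inductive IsMorleyList (A : Set N) : List (GlobalType L N n) → List (Fin n → N) → Prop
  | nil : IsMorleyList A [] []
  | cons {p : GlobalType L N n} {ps : List (GlobalType L N n)} {c : Fin n → N}
      {l : List (Fin n → N)} (h : IsMorleyList A ps l) (hc : p.IsRealizedOver (A ∪ entries l) c) :
      IsMorleyList A (p :: ps) (c :: l)

theorem IsMorleyList.length_eq (h : IsMorleyList A ps l) : l.length = ps.length := by
  induction h with
  | nil => rfl
  | cons _ _ ih => simp [ih]

theorem IsMorleyList.mono {B : Set N} (h : IsMorleyList B ps l) (hAB : A ⊆ B) :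
    IsMorleyList A ps l := by
  induction h with
  | nil => exact .nil
  | cons _ hc ih => exact .cons ih (hc.mono (Set.union_subset_union_left _ hAB))

theorem IsMorleyList.append (h : IsMorleyList A ps l)
    (h' : IsMorleyList (A ∪ entries l) ps' l') : IsMorleyList A (ps' ++ ps) (l' ++ l) := by
  induction h' with
  | nil => exact h
  | cons _ hc ih =>
    refine .cons ih (hc.mono ?_)
    rw [Set.union_assoc]
    refine Set.union_subset_union_right _ ?_
    simp [entries, Set.iUnion_or, Set.iUnion_union_distrib, Set.union_comm]

theorem IsMorleyList.exists_sublist (h : IsMorleyList A ps l) (hps : ps'.Sublist ps) :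
    ∃ l', l'.Sublist l ∧ IsMorleyList A ps' l' := by
  induction h generalizing ps' with
  | nil => exact ⟨[], .slnil, by rw [List.sublist_nil.1 hps]; exact .nil⟩
  | cons _ hc ih =>
    cases hps with
    | cons _ hps =>
      obtain ⟨l', hl', h⟩ := ih hps
      exact ⟨l', hl'.cons _, h⟩
    | cons_cons _ hps =>
      obtain ⟨l', hl', h⟩ := ih hps
      exact ⟨_ :: l', hl'.cons_cons _, .cons h (hc.mono
        (Set.union_subset_union_right _ (entries_subset_of_subset hl'.subset)))⟩

theorem mk_union_entries_lt (hκ : Cardinal.aleph0 < κ) (hA : Cardinal.mk A < κ)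
    (l : List (Fin n → N)) : Cardinal.mk ↥(A ∪ entries l) < κ :=
  (Cardinal.mk_union_le _ _).trans_lt (Cardinal.add_lt_of_lt hκ.le hA
    ((finite_entries l).lt_aleph0.trans hκ))

theorem exists_isMorleyList (hN : IsSaturated L κ N) (hκ : Cardinal.aleph0 < κ)
    (hA : Cardinal.mk A < κ) (ps : List (GlobalType L N n)) : ∃ l, IsMorleyList A ps l := by
  induction ps with
  | nil => exact ⟨[], .nil⟩
  | cons p ps ih =>
    obtain ⟨l, hl⟩ := ih
    obtain ⟨c, hc⟩ := p.exists_isRealizedOver hN (mk_union_entries_lt hκ hA l)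
    exact ⟨c :: l, .cons hl hc⟩

theorem sameTypeOver_entries_cons_iff {ι : Type*} {x y : ι → N} {f : Fin n → ι}
    {s : List (Fin n → ι)} :
    SameTypeOver L A (fun i : entries (f :: s) => x i) (fun i : entries (f :: s) => y i) ↔
      SameTypeOver L A (Sum.elim (x ∘ f) fun i : entries s => x i)
        (Sum.elim (y ∘ f) fun i : entries s => y i) := by
  have hf (t : Fin n) : f t ∈ entries (f :: s) := by simp [entries_cons]
  have hs (i : entries s) : i.1 ∈ entries (f :: s) := by simp [entries_cons]
  have hentry (i : entries (f :: s)) : ∃ z : Fin n ⊕ entries s, Sum.elim f (↑) z = i.1 := by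
    simpa [entries_cons] using i.2
  choose g hg using hentry
  constructor
  · exact fun h => h.reindex
      (Sum.map (Sum.elim (fun t => ⟨f t, hf t⟩) fun i : entries s => ⟨i, hs i⟩) id)
  · refine fun h => h.reindex (Sum.map g id) ?_ ?_ <;>
    · rintro (i | i)
      · rw [Sum.map_inl, Sum.elim_inl, Sum.elim_inl, ← hg i]
        rcases g i with _ | _ <;> rfl
      · rfl

theorem IsMorleyList.map_iff_sameTypeOver (hps : ∀ p ∈ ps, p.IsInvariant A) {ι : Type*}
    {x y : ι → N} {s : List (Fin n → ι)} (h : IsMorleyList A ps (s.map (x ∘ ·))) :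
    IsMorleyList A ps (s.map (y ∘ ·)) ↔
      SameTypeOver L A (fun i : entries s => x i) (fun i : entries s => y i) := by
  induction s generalizing ps with
  | nil =>
    have : IsEmpty (entries ([] : List (Fin n → ι))) := by simp [entries]
    refine iff_of_true h ?_
    rw [Subsingleton.elim (fun i : entries ([] : List (Fin n → ι)) => x i) fun i => y i]
    exact fun _ => Iff.rfl
  | cons f s ih =>
    obtain _ | @⟨p, ps, _, _, h, hc⟩ := h
    obtain ⟨hp, hps⟩ := List.forall_mem_cons.1 hps
    rw [entries_map] at hc
    rw [sameTypeOver_entries_cons_iff]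
    constructor
    · rintro (_ | ⟨h', hc'⟩)
      rw [entries_map] at hc'
      exact (p.isRealizedOver_iff_sameTypeOver hp ((ih hps h).1 h') hc).1 hc'
    · intro hxy
      have hxy' : SameTypeOver L A (fun i : entries s => x i) fun i => y i :=
        hxy.reindex (Sum.map Sum.inr id)
      refine .cons ((ih hps h).2 hxy') ?_
      rw [entries_map]
      exact (p.isRealizedOver_iff_sameTypeOver hp hxy' hc).2 hxy

end MorleyList

section ConsistentAlong

variable {L : FirstOrder.Language.{u, v}} {N : Type w} [L.Structure N] {A : Set N} {m n : ℕ}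
  {φ : L.Formula (Fin m ⊕ Fin n)} {ps ps' : List (GlobalType L N n)} {l : List (Fin n → N)}
  {q : GlobalType L N n} {b : ℕ → Fin n → N} {κ : Cardinal.{w}}

/-- The formula `φ(x; y)` is consistent along some Morley list over `A` in the types `ps`. When
these types are `A`-invariant, it is then consistent along every such list. -/
def ConsistentAlong (A : Set N) (φ : L.Formula (Fin m ⊕ Fin n)) (ps : List (GlobalType L N n)) :
    Prop :=
  ∃ l, IsMorleyList A ps l ∧ ∃ a, ∀ c ∈ l, φ.Realize (Sum.elim a c)

theorem ConsistentAlong.sublist (h : ConsistentAlong A φ ps) (hps : ps'.Sublist ps) :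
    ConsistentAlong A φ ps' := by
  obtain ⟨l, hl, a, ha⟩ := h
  obtain ⟨l', hl', h'⟩ := hl.exists_sublist hps
  exact ⟨l', h', a, fun c hc => ha c (hl'.subset hc)⟩

theorem exists_map_comp_eq {l l' : List (Fin n → N)} {k : ℕ} (h : l.length = k)
    (h' : l'.length = k) : ∃ (s : List (Fin n → Fin k × Fin n)) (x y : Fin k × Fin n → N),
      l = s.map (x ∘ ·) ∧ l' = s.map (y ∘ ·) := by
  refine ⟨List.ofFn fun i t => (i, t), fun p => l[p.1] p.2, fun p => l'[p.1] p.2, ?_, ?_⟩ <;>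
    exact List.ext_getElem (by simp [h, h']) fun i _ _ => by ext t; simp

theorem ConsistentAlong.exists_realize (h : ConsistentAlong A φ ps)
    (hps : ∀ p ∈ ps, p.IsInvariant A) (hl : IsMorleyList A ps l) :
    ∃ a, ∀ c ∈ l, φ.Realize (Sum.elim a c) := by
  obtain ⟨l', hl', a, ha⟩ := h
  obtain ⟨s, x, y, rfl, rfl⟩ := exists_map_comp_eq hl'.length_eq hl.length_eq
  have hxy := ((hl'.map_iff_sameTypeOver hps).1 hl).reindex Sum.inl
    (x' := fun i : entries s => x i) (y' := fun i : entries s => y i)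
  have hmem (f : {f // f ∈ s}) (t : Fin n) : f.1 t ∈ entries s :=
    Set.mem_biUnion f.2 (Set.mem_range_self t)
  obtain ⟨a', ha'⟩ := (hxy.exists_iff fun f : {f // f ∈ s} =>
    φ.relabel (Sum.map id fun t => ⟨f.1 t, hmem f t⟩)).1
      ⟨a, fun f => (realize_relabel_map_id _ _ _ _).2 (ha _ (List.mem_map_of_mem f.2))⟩
  refine ⟨a', fun c hc => ?_⟩
  obtain ⟨f, hf, rfl⟩ := List.mem_map.1 hc
  exact (realize_relabel_map_id φ (fun t => (⟨f t, hmem ⟨f, hf⟩ t⟩ : entries s)) a'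
    (fun i : entries s => y i)).1 (ha' ⟨f, hf⟩)

theorem below_eq_union_entries (A : Set N) (b : ℕ → Fin n → N) (i : ℕ) :
    below A b i = A ∪ entries ((List.range i).map b) := by
  ext a
  simp [below, entries, eq_comm]

theorem exists_isMorleySequence (hN : IsSaturated L κ N) (hκ : Cardinal.aleph0 < κ)
    (q : GlobalType L N n) (hA : Cardinal.mk A < κ) : ∃ b, IsMorleySequence q.formulas A b := by
  obtain ⟨b, hb⟩ := exists_seq_of_forall_list fun l : List (Fin n → N) =>
    q.exists_isRealizedOver hN (mk_union_entries_lt hκ hA l)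
  exact ⟨b, fun i => below_eq_union_entries A b i ▸ hb i⟩

theorem IsMorleySequence.isMorleyList (h : IsMorleySequence q.formulas A b) (i : ℕ) :
    IsMorleyList A (List.replicate i q) ((List.range i).map b).reverse := by
  induction i with
  | zero => exact .nil
  | succ i ih =>
    rw [List.range_succ, List.map_append, List.reverse_append, List.replicate_succ]
    refine .cons ih (GlobalType.IsRealizedOver.mono (h i) ?_)
    rw [below_eq_union_entries]
    exact Set.union_subset_union_right _ (entries_subset_of_subset
      (List.reverse_subset.2 (List.Subset.refl _)))

theorem qDivides_iff_exists_not_consistentAlong (hN : IsSaturated L κ N)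
    (hκ : Cardinal.aleph0 < κ) (hA : Cardinal.mk A < κ) (hq : q.IsInvariant A) :
    QDivides φ q A ↔ ∃ i, ¬ ConsistentAlong A φ (List.replicate i q) := by
  constructor
  · rintro ⟨b, hb, hφ⟩
    by_contra! h
    refine hφ fun F => ?_
    obtain ⟨a, ha⟩ := (h (F.sup id + 1)).exists_realize
      (fun p hp => List.eq_of_mem_replicate hp ▸ hq) (hb.isMorleyList _)
    exact ⟨a, fun i hi => ha _ (by
      simpa using ⟨i, Finset.le_sup (f := id) hi, rfl⟩)⟩
  · rintro ⟨i, hi⟩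
    obtain ⟨b, hb⟩ := exists_isMorleySequence hN hκ q hA
    refine ⟨b, hb, fun hφ => hi ⟨_, hb.isMorleyList i, ?_⟩⟩
    obtain ⟨a, ha⟩ := hφ (Finset.range i)
    exact ⟨a, by simpa using ha⟩

end ConsistentAlong

section Compactness

variable {L : FirstOrder.Language.{u, v}} {m n : ℕ} {φ : L.Formula (Fin m ⊕ Fin n)}
  {P Q : Type*} [L.Structure P] [L.Structure Q]

theorem consistent_pair_iff {b c : Fin n → P} :
    Consistent φ ![b, c] ↔ ∃ a, φ.Realize (Sum.elim a b) ∧ φ.Realize (Sum.elim a c) := by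
  constructor
  · intro h
    obtain ⟨a, ha⟩ := h Finset.univ
    exact ⟨a, ha 0 (by simp), ha 1 (by simp)⟩
  · rintro ⟨a, hb, hc⟩ s
    exact ⟨a, fun i _ => by fin_cases i <;> assumption⟩

theorem consistent_comp_iff (g : P ↪ₑ[L] Q) {ι : Type*} {b : ι → Fin n → P} :
    Consistent φ (fun i => g ∘ b i) ↔ Consistent φ b := by
  refine forall_congr' fun s => ?_
  simpa only [realize_relabel_map_id, Function.comp_id, Function.id_comp, Subtype.forall] using
    ((sameType_elementaryEmbedding g id).exists_iff
      fun i : s => φ.relabel (Sum.map id (b i))).symm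

theorem consistent_comp_pair_iff (g : P ↪ₑ[L] Q) {b c : Fin n → P} :
    Consistent φ ![g ∘ b, g ∘ c] ↔ Consistent φ ![b, c] := by
  rw [← consistent_comp_iff g]
  exact iff_of_eq (congrArg _ (by ext i; fin_cases i <;> rfl))

variable (φ) in
/-- The tuples `a η` witness that `φ(x; y)` has SOP₁. -/
def IsSOP1Tree (a : List Bool → Fin n → P) : Prop :=
  (∀ η : ℕ → Bool, Consistent φ (fun k : ℕ => a ((List.range k).map η))) ∧
    ∀ η ν : List Bool, (η ++ [false]) <+: ν → ¬ Consistent φ ![a ν, a (η ++ [true])]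

theorem isSOP1Tree_comp_iff (g : P ↪ₑ[L] Q) {a : List Bool → Fin n → P} :
    IsSOP1Tree φ (fun η => g ∘ a η) ↔ IsSOP1Tree φ a := by
  simp only [IsSOP1Tree, consistent_comp_iff g, consistent_comp_pair_iff g]

/-- The downward Löwenheim–Skolem theorem, with a model in the universe of the language. -/
theorem exists_modelType_subset_range {T : L.Theory} [Nonempty P] [P ⊨ T] (s : Set P)
    [Small.{max u v} s] :
    ∃ (M : Theory.ModelType.{u, v, max u v} T) (g : M ↪ₑ[L] P), s ⊆ Set.range g := by
  let S := (Substructure.closure (L.sum L.skolem₁) s).elementarySkolem₁Reduct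
  have hs : s ⊆ S := Substructure.subset_closure
  have : Small.{max u v} S :=
    inferInstanceAs (Small.{max u v} (Substructure.closure (L.sum L.skolem₁) s))
  let e := equivShrink.{max u v} S
  let _ : L.Structure (Shrink.{max u v} S) := e.inducedStructure
  have : Nonempty (Shrink.{max u v} S) := e.symm.nonempty
  have : Shrink.{max u v} S ⊨ T := StrongHomClass.theory_model (e.inducedStructureEquiv (L := L))
  exact ⟨.of T (Shrink.{max u v} S),
    S.subtype.comp (e.inducedStructureEquiv (L := L)).symm.toElementaryEmbedding,
    fun a ha => ⟨e ⟨a, hs ha⟩, congrArg Subtype.val (e.symm_apply_apply ⟨a, hs ha⟩)⟩⟩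

theorem sop1_of_isSOP1Tree {T : L.Theory} [Nonempty P] [P ⊨ T] {a : List Bool → Fin n → P}
    (h : IsSOP1Tree φ a) : SOP1 T := by
  have : Countable (Set.range fun p : List Bool × Fin n => a p.1 p.2) := Set.countable_range _
  have := Countable.toSmall.{max u v} (Set.range fun p : List Bool × Fin n => a p.1 p.2)
  obtain ⟨M, g, hg⟩ := exists_modelType_subset_range (T := T)
    (Set.range fun p : List Bool × Fin n => a p.1 p.2)
  choose b hb using fun η t => hg ⟨(η, t), rfl⟩
  obtain rfl : (fun η => g ∘ b η) = a := funext fun η => funext (hb η)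
  exact ⟨M, m, n, φ, b, (isSOP1Tree_comp_iff g).1 h⟩

section Ultrapower

variable {I : Type*} (U : Ultrafilter I) {β γ : Type*}

theorem ultrapower_models [Nonempty P] (T : L.Theory) [P ⊨ T] :
    (U : Filter I).Product (fun _ => P) ⊨ T :=
  Theory.model_iff _ |>.2 fun _ hσ => (Ultraproduct.sentence_realize _).2
    (.of_forall fun _ => Theory.realize_sentence_of_mem T hσ)

/-- The tuple of elements of an ultrapower of `P` represented by a family of tuples of `P`. -/
def ultrapowerTuple (x : I → β → P) (t : β) : (U : Filter I).Product fun _ => P :=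
  ((fun i => x i t : I → P) : (U : Filter I).Product fun _ => P)

theorem exists_ultrapowerTuple_eq (a : β → (U : Filter I).Product fun _ => P) :
    ∃ x : I → β → P, ultrapowerTuple U x = a := by
  choose x hx using fun t => Quotient.exists_rep (a t)
  exact ⟨fun i t => x t i, funext hx⟩

theorem elim_ultrapowerTuple (x : I → β → P) (y : I → γ → P) :
    Sum.elim (ultrapowerTuple U x) (ultrapowerTuple U y) =
      ultrapowerTuple U fun i => Sum.elim (x i) (y i) := by
  ext (_ | _) <;> rfl

theorem realize_ultrapowerTuple [Nonempty P] {θ : L.Formula β} {x : I → β → P} :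
    θ.Realize (ultrapowerTuple U x) ↔ ∀ᶠ i in (U : Filter I), θ.Realize (x i) :=
  Ultraproduct.realize_formula_cast (M := fun _ : I => P) θ fun t i => x i t

end Ultrapower

theorem sop1_of_finite_trees {T : L.Theory} [Nonempty P] [P ⊨ T] {β : Type*} [Finite β]
    {φ : L.Formula (Fin m ⊕ β)} {a : ℕ → List Bool → β → P}
    (hpath : ∀ η : List Bool, ∃ x, ∀ ν, ν <+: η → φ.Realize (Sum.elim x (a η.length ν)))
    (hsplit : ∀ h (η ν : List Bool), (η ++ [false]) <+: ν → ν.length ≤ h →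
      ¬ ∃ x, φ.Realize (Sum.elim x (a h ν)) ∧ φ.Realize (Sum.elim x (a h (η ++ [true])))) :
    SOP1 T := by
  let U : Ultrafilter ℕ := Filter.hyperfilter ℕ
  have eventually_ge (k : ℕ) : ∀ᶠ h in (U : Filter ℕ), k ≤ h :=
    Nat.hyperfilter_le_atTop (Filter.eventually_ge_atTop k)
  have := ultrapower_models (P := P) U T
  let e := Finite.equivFin β
  have realize_iff (x : ℕ → Fin m → P) (ν : List Bool) :
      (φ.relabel (Sum.map id e)).Realize
        (Sum.elim (ultrapowerTuple U x) (ultrapowerTuple U fun h => a h ν ∘ e.symm)) ↔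
        ∀ᶠ h in (U : Filter ℕ), φ.Realize (Sum.elim (x h) (a h ν)) := by
    simp only [elim_ultrapowerTuple, realize_ultrapowerTuple, realize_relabel_map_id,
      Function.comp_assoc, Equiv.symm_comp_self, Function.comp_id]
  refine sop1_of_isSOP1Tree (φ := φ.relabel (Sum.map id e))
    (a := fun ν => ultrapowerTuple U fun h => a h ν ∘ e.symm) ⟨fun η s => ?_, fun η ν hν hc => ?_⟩
  · choose x hx using hpath
    refine ⟨ultrapowerTuple U fun h => x ((List.range h).map η), fun k _ => ?_⟩
    rw [realize_iff]
    filter_upwards [eventually_ge k] with h hkh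
    have hprefix : (List.range k).map η <+: (List.range h).map η := by
      obtain ⟨d, rfl⟩ := Nat.exists_eq_add_of_le hkh
      rw [List.range_add, List.map_append]
      exact List.prefix_append _ _
    simpa using hx _ _ hprefix
  · obtain ⟨x, hx, hx'⟩ := consistent_pair_iff.1 hc
    obtain ⟨x, rfl⟩ := exists_ultrapowerTuple_eq U x
    rw [realize_iff] at hx hx'
    obtain ⟨h, hh, hh', hνh⟩ := (hx.and (hx'.and (eventually_ge ν.length))).exists
    exact hsplit h η ν hν hνh ⟨_, hh, hh'⟩

end Compactness

section AverageType

variable {L : FirstOrder.Language.{u, v}} {N : Type w} [L.Structure N] {m n : ℕ} {A : Set N}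
  {φ : L.Formula (Fin m ⊕ Fin n)} {κ : Cardinal.{w}}

theorem GlobalType.IsRealizedOver.tp_eq {q : GlobalType L N n} {c : Fin n → N}
    (hc : q.IsRealizedOver A c) : tp L c A = formulasOver n A ∩ q.formulas := by
  obtain ⟨P, _, j, d, hq⟩ := q.exists_isRealization
  have hdc := (hq.isRealizedOver_range_iff (x := ((↑) : A → N))).1 (by rwa [Subtype.range_coe])
  ext ψ
  refine and_congr_right ?_
  rintro ⟨k, θ, a, ha, rfl⟩
  rw [hq, realize_inst]
  exact (hdc.reindex (Sum.map id fun i => ⟨a i, ha i⟩) (by simp) (by simp) θ).symm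

theorem GlobalType.isRealizedOver_iff_tp_subset {q : GlobalType L N n} {c : Fin n → N} :
    q.IsRealizedOver A c ↔ tp L c A ⊆ q.formulas := by
  refine ⟨fun hc => hc.tp_eq ▸ Set.inter_subset_right, ?_⟩
  rintro hc _ ⟨hψ, k, θ, a, ha, rfl⟩
  obtain ⟨P, _, j, d, hq⟩ := q.exists_isRealization
  by_contra hθ
  have hnot : inst θ.not a ∈ tp L c A :=
    ⟨⟨k, θ.not, a, ha, rfl⟩, by rwa [realize_inst, Formula.realize_not, ← realize_inst]⟩
  exact Formula.realize_not.1 ((hq k θ.not a).1 (hc hnot)) ((hq k θ a).1 hψ)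

variable [Nonempty N] {I : Set (Fin n → N)}

variable (L) in
/-- The global average type `Av(D, N)` of an ultrafilter `D` on a set of tuples: the type over `N`
of the class of the inclusion of this set in the ultrapower of `N` by `D`. -/
noncomputable def averageType (D : Ultrafilter I) : GlobalType L N n :=
  let _ : L[[N]].Structure ((D : Filter I).Product fun _ => N) := Ultraproduct.structure
  have : ((D : Filter I).Product fun _ => N) ⊨ L.elementaryDiagram N := ultrapower_models D _
  (L.elementaryDiagram N).typeOf (ultrapowerTuple D ((↑) : I → Fin n → N))

theorem mem_formulas_averageType {D : Ultrafilter I} {ψ : L[[N]].Formula (Fin n)} :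
    ψ ∈ (averageType L D).formulas ↔ ∀ᶠ c : I in (D : Filter I), ψ.Realize (c : Fin n → N) := by
  let _ : L[[N]].Structure ((D : Filter I).Product fun _ => N) := Ultraproduct.structure
  have : ((D : Filter I).Product fun _ => N) ⊨ L.elementaryDiagram N := ultrapower_models D _
  exact (Theory.CompleteType.formula_mem_typeOf (T := L.elementaryDiagram N)).trans
    (realize_ultrapowerTuple D)

theorem average_eq_inter (D : Ultrafilter I) (A : Set N) :
    average (L := L) D A = formulasOver n A ∩ (averageType L D).formulas :=
  Set.ext fun _ => and_congr_right fun _ => mem_formulas_averageType.symm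

theorem average_univ_inter_formulasOver (D : Ultrafilter I) (A : Set N) :
    average (L := L) D Set.univ ∩ formulasOver n A =
      (averageType L D).formulas ∩ formulasOver n A := by
  rw [average_eq_inter, Set.inter_right_comm,
    Set.inter_eq_self_of_subset_right (formulasOver_mono (Set.subset_univ A)), Set.inter_comm]

theorem isInvariant_averageType (D : Ultrafilter (tuples n A)) :
    (averageType L D).IsInvariant A := by
  intro k θ c c' h
  rw [mem_formulas_averageType, mem_formulas_averageType]
  refine Filter.eventually_congr (.of_forall fun b => ?_)
  rw [realize_inst, realize_inst]
  refine (tp_eq_tp_iff.1 h).reindex (Sum.elim (fun t => Sum.inr ⟨b.1 t, b.2 t⟩) Sum.inl) ?_ ?_ θ <;>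
    exact Sum.forall.2 ⟨fun _ => rfl, fun _ => rfl⟩

theorem qDivides_averageType_iff {D : Ultrafilter (tuples n A)} :
    QDivides φ (averageType L D) A ↔ ¬ IsHigher φ A D := by
  simp only [IsHigher, QDivides, IsMorleySequence, average_univ_inter_formulasOver, not_forall,
    exists_prop]

variable (L) in
/-- Higher formulas are independent of the ultrafilter: for ultrafilters on tuples from `A` with
the same average type over `A`, the same formulas are higher. -/
def UltrafilterIndependence (A : Set N) : Prop :=
  ∀ (m n : ℕ) (φ : L.Formula (Fin m ⊕ Fin n)) (D E : Ultrafilter (tuples n A)),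
    average (L := L) D A = average (L := L) E A → (IsHigher φ A D ↔ IsHigher φ A E)

variable (L) in
/-- Kim's lemma for Kim-dividing over `A`: a formula that divides in some `A`-invariant global
extension of a type over `A` divides in all of them. -/
def KimLemma (A : Set N) : Prop :=
  ∀ (m n : ℕ) (φ : L.Formula (Fin m ⊕ Fin n)) (b : Fin n → N),
    (∃ q : GlobalType L N n, q.IsInvariant A ∧ tp L b A ⊆ q.formulas ∧ QDivides φ q A) →
      ∀ q : GlobalType L N n, q.IsInvariant A → tp L b A ⊆ q.formulas → QDivides φ q A

theorem KimLemma.ultrafilterIndependence (h : KimLemma L A) (hN : IsSaturated L κ N)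
    (hA : Cardinal.mk A < κ) : UltrafilterIndependence L A := by
  intro m n φ D E hDE
  obtain ⟨c, hc⟩ := (averageType L D).exists_isRealizedOver hN hA
  have hcD := GlobalType.isRealizedOver_iff_tp_subset.1 hc
  have hcE : tp L c A ⊆ (averageType L E).formulas := by
    rw [hc.tp_eq, ← average_eq_inter, hDE, average_eq_inter]
    exact Set.inter_subset_right
  rw [← not_iff_not, ← qDivides_averageType_iff, ← qDivides_averageType_iff]
  exact ⟨fun hD => h m n φ c ⟨_, isInvariant_averageType D, hcD, hD⟩ _
      (isInvariant_averageType E) hcE,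
    fun hE => h m n φ c ⟨_, isInvariant_averageType E, hcE, hE⟩ _ (isInvariant_averageType D) hcD⟩

end AverageType

section BlockTree

variable {L : FirstOrder.Language.{u, v}} {N : Type w} [L.Structure N] {n k h : ℕ} {A : Set N}
  {q r : GlobalType L N n} {κ : Cardinal.{w}} {X Y : Type*}

/-- The tuples in the blocks along the path from the root to `η`, starting at the root. -/
def pathList (a : List Bool → Fin k → Fin n → X) (η : List Bool) : List (Fin n → X) :=
  η.inits.flatMap fun ν => List.ofFn (a ν)

theorem mem_pathList {a : List Bool → Fin k → Fin n → X} {η : List Bool} {c : Fin n → X} :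
    c ∈ pathList a η ↔ ∃ ν, ν <+: η ∧ ∃ i, a ν i = c := by
  simp [pathList, List.mem_ofFn]

theorem map_pathList (f : X → Y) (a : List Bool → Fin k → Fin n → X) (η : List Bool) :
    (pathList a η).map (f ∘ ·) = pathList (fun ν i => f ∘ a ν i) η := by
  simp [pathList, List.map_flatMap, List.map_ofFn, Function.comp_def]

/-- The binary tree with root `f`, left subtree `a` and right subtree `b`. -/
def graft (f : X) (a b : List Bool → X) : List Bool → X
  | [] => f
  | e :: ν => bif e then b ν else a ν

theorem pathList_graft_cons (f : Fin k → Fin n → X) (a b : List Bool → Fin k → Fin n → X)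
    (e : Bool) (η : List Bool) :
    pathList (graft f a b) (e :: η) = List.ofFn f ++ pathList (bif e then b else a) η := by
  cases e <;> simp [pathList, graft, List.flatMap_map]

/-- The entries of a tree of blocks of tuples, as a single family. -/
def treeEntry (a : List Bool → Fin k → Fin n → X) (p : List Bool × Fin k × Fin n) : X :=
  a p.1 p.2.1 p.2.2

theorem entries_subset_range_treeEntry {a : List Bool → Fin k → Fin n → X} {l : List (Fin n → X)}
    (hl : ∀ c ∈ l, ∃ ν i, a ν i = c) : entries l ⊆ Set.range (treeEntry a) := by
  refine Set.iUnion₂_subset fun c hc => ?_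
  obtain ⟨ν, i, rfl⟩ := hl c hc
  exact Set.range_subset_iff.2 fun t => ⟨(ν, i, t), rfl⟩

/-- A binary tree of height `h` of blocks of `k + 1` tuples. The blocks along a path form a Morley
list in `r`. The first tuple of the right successor of a node realizes `q` over each block in the
left subtree of this node. -/
structure IsBlockTree (A : Set N) (q r : GlobalType L N n) (h : ℕ)
    (a : List Bool → Fin (k + 1) → Fin n → N) : Prop where
  path : ∀ η : List Bool, η.length = h → ∃ i, IsMorleyList A (List.replicate i r) (pathList a η)
  node : ∀ ν : List Bool, ν.length ≤ h →
    IsMorleyList A (List.replicate (k + 1) r) (List.ofFn (a ν))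
  split : ∀ η ν : List Bool, (η ++ [false]) <+: ν → ν.length ≤ h →
    IsMorleyList A (q :: List.replicate (k + 1) r) (a (η ++ [true]) 0 :: List.ofFn (a ν))

variable {a b : List Bool → Fin (k + 1) → Fin n → N} {f : Fin (k + 1) → Fin n → N}

theorem IsBlockTree.isRealizedOver_root (ha : IsBlockTree A q r h a) :
    r.IsRealizedOver A (a [] 0) := by
  have hroot := ha.node [] (Nat.zero_le _)
  rw [List.ofFn_succ, List.replicate_succ] at hroot
  cases hroot with
  | cons _ hc => exact hc.mono Set.subset_union_left

theorem IsBlockTree.of_sameTypeOver (ha : IsBlockTree A q r h a) (hq : q.IsInvariant A)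
    (hr : r.IsInvariant A) (hab : SameTypeOver L A (treeEntry a) (treeEntry b)) :
    IsBlockTree A q r h b := by
  have hinv {i} : ∀ p ∈ List.replicate i r, p.IsInvariant A := fun p hp =>
    List.eq_of_mem_replicate hp ▸ hr
  have transfer {ps : List (GlobalType L N n)} (hps : ∀ p ∈ ps, p.IsInvariant A)
      {s : List (Fin n → List Bool × Fin (k + 1) × Fin n)}
      (h : IsMorleyList A ps (s.map (treeEntry a ∘ ·))) :
      IsMorleyList A ps (s.map (treeEntry b ∘ ·)) :=
    (h.map_iff_sameTypeOver hps).2 (hab.reindex (Sum.map (fun i : entries s => i.1) id))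
  let index (ν : List Bool) (i : Fin (k + 1)) (t : Fin n) := (ν, i, t)
  refine ⟨fun η hη => ?_, fun ν hν => ?_, fun η ν hην hν => ?_⟩
  · obtain ⟨i, hi⟩ := ha.path η hη
    refine ⟨i, ?_⟩
    have := transfer (s := pathList index η) hinv (by rw [map_pathList]; exact hi)
    rwa [map_pathList] at this
  · have := transfer (s := List.ofFn (index ν)) hinv (by rw [List.map_ofFn]; exact ha.node ν hν)
    rwa [List.map_ofFn] at this
  · have := transfer (s := index (η ++ [true]) 0 :: List.ofFn (index ν))
      (List.forall_mem_cons.2 ⟨hq, hinv⟩)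
      (by rw [List.map_cons, List.map_ofFn]; exact ha.split η ν hην hν)
    rwa [List.map_cons, List.map_ofFn] at this

theorem mk_union_range_lt (hκ : Cardinal.aleph0 < κ) (hA : Cardinal.mk A < κ) {ι : Type*}
    [Countable ι] (x : ι → N) : Cardinal.mk ↥(A ∪ Set.range x) < κ :=
  (Cardinal.mk_union_le _ _).trans_lt (Cardinal.add_lt_of_lt hκ.le hA
    ((Set.countable_range x).le_aleph0.trans_lt hκ))

theorem IsBlockTree.exists_copy (ha : IsBlockTree A q r h a) (hN : IsSaturated L κ N)
    (hκ : Cardinal.aleph0 < κ) (hA : Cardinal.mk A < κ) (hq : q.IsInvariant A)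
    (hr : r.IsInvariant A) {c : Fin n → N} (hc : SameTypeOver L A (a [] 0) c) :
    ∃ b : List Bool → Fin (k + 1) → Fin n → N, IsBlockTree A q r h b ∧ b [] 0 = c := by
  obtain ⟨y, hy⟩ := hN.exists_family hκ hc (by
    rw [Set.Sum.elim_range, Subtype.range_coe, Set.union_comm]
    exact mk_union_range_lt hκ hA c) (treeEntry a) (by
      rw [Cardinal.lift_uzero]
      exact (Cardinal.lift_le_aleph0.2 Cardinal.mk_le_aleph0).trans_lt hκ)
  refine ⟨fun ν i t => y (ν, i, t), ha.of_sameTypeOver hq hr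
    (hy.reindex (Sum.map id Sum.inr) (by simp) (by rintro (_ | _) <;> rfl)), funext fun t => ?_⟩
  exact hy.eq_of_eq (i := Sum.inl ([], 0, t)) (j := Sum.inr (Sum.inl t)) rfl

theorem IsBlockTree.graft (ha : IsBlockTree A q r h a) (hb : IsBlockTree A q r h b)
    (hroot : q.IsRealizedOver (A ∪ Set.range (treeEntry a)) (b [] 0))
    (hf : IsMorleyList (A ∪ Set.range (treeEntry a) ∪ Set.range (treeEntry b))
      (List.replicate (k + 1) r) (List.ofFn f)) :
    IsBlockTree A q r (h + 1) (graft f a b) := by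
  have subtree (e : Bool) : IsBlockTree A q r h (bif e then b else a) := by cases e <;> assumption
  refine ⟨fun η hη => ?_, fun ν hν => ?_, fun η ν hην hν => ?_⟩
  · obtain _ | ⟨e, η⟩ := η
    · simp at hη
    obtain ⟨i, hi⟩ := (subtree e).path η (by simpa using hη)
    have hf' : IsMorleyList (A ∪ entries (pathList (bif e then b else a) η))
        (List.replicate (k + 1) r) (List.ofFn f) := by
      have hentries := entries_subset_range_treeEntry fun c hc =>
        (mem_pathList (a := bif e then b else a) (η := η) (c := c)).1 hc |>.imp fun _ => And.right
      refine hf.mono ((Set.union_subset_union_right A hentries).trans ?_)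
      cases e
      · exact Set.subset_union_left
      · exact Set.union_subset_union_left _ Set.subset_union_left
    exact ⟨_, by simpa only [pathList_graft_cons, List.replicate_append_replicate]
      using hi.append hf'⟩
  · obtain _ | ⟨e, ν⟩ := ν
    · exact hf.mono (Set.subset_union_left.trans Set.subset_union_left)
    · cases e
      · exact ha.node ν (by simpa using hν)
      · exact hb.node ν (by simpa using hν)
  · obtain _ | ⟨e, ν⟩ := ν
    · simp at hην
    obtain _ | ⟨e', η⟩ := η
    · obtain rfl : e = false := by simpa [eq_comm] using hην
      refine .cons (ha.node ν (by simpa using hν)) (hroot.mono (Set.union_subset_union_right A ?_))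
      exact entries_subset_range_treeEntry fun c hc => ⟨ν, (List.mem_ofFn' _ _).1 hc⟩
    · obtain ⟨rfl, hprefix⟩ := List.cons_prefix_cons.1 hην
      cases e'
      · exact ha.split η ν hprefix (by simpa using hν)
      · exact hb.split η ν hprefix (by simpa using hν)

theorem exists_isMorleyList_ofFn (hN : IsSaturated L κ N) (hκ : Cardinal.aleph0 < κ)
    (hA : Cardinal.mk A < κ) (q : GlobalType L N n) (i : ℕ) :
    ∃ f : Fin i → Fin n → N, IsMorleyList A (List.replicate i q) (List.ofFn f) := by
  obtain ⟨l, hl⟩ := exists_isMorleyList hN hκ hA (List.replicate i q)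
  obtain rfl : l.length = i := by simpa using hl.length_eq
  exact ⟨l.get, by simpa using hl⟩

theorem exists_isBlockTree (hN : IsSaturated L κ N) (hκ : Cardinal.aleph0 < κ)
    (hA : Cardinal.mk A < κ) (hq : q.IsInvariant A) (hr : r.IsInvariant A) {c : Fin n → N}
    (hcq : q.IsRealizedOver A c) (hcr : r.IsRealizedOver A c) (k h : ℕ) :
    ∃ a : List Bool → Fin (k + 1) → Fin n → N, IsBlockTree A q r h a := by
  induction h with
  | zero =>
    obtain ⟨f, hf⟩ := exists_isMorleyList_ofFn hN hκ hA r (k + 1)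
    refine ⟨fun _ => f, fun η hη => ⟨k + 1, ?_⟩, fun _ _ => hf, fun η ν hην hν => ?_⟩
    · obtain rfl := List.length_eq_zero_iff.1 hη
      simpa [pathList] using hf
    · obtain rfl := List.length_eq_zero_iff.1 (Nat.le_zero.1 hν)
      simp at hην
  | succ h ih =>
    obtain ⟨a, ha⟩ := ih
    have haA := mk_union_range_lt hκ hA (treeEntry a)
    obtain ⟨d, hd⟩ := q.exists_isRealizedOver hN haA
    have hroot : SameTypeOver L A (a [] 0) d := tp_eq_tp_iff.1 <|
      ha.isRealizedOver_root.tp_eq.trans <| hcr.tp_eq.symm.trans <|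
        hcq.tp_eq.trans (hd.mono Set.subset_union_left).tp_eq.symm
    obtain ⟨b, hb, rfl⟩ := ha.exists_copy hN hκ hA hq hr hroot
    obtain ⟨f, hf⟩ := exists_isMorleyList_ofFn hN hκ
      (mk_union_range_lt hκ haA (treeEntry b)) r (k + 1)
    exact ⟨_, ha.graft hb hd hf⟩

end BlockTree

section KimLemma

variable {L : FirstOrder.Language.{u, v}} {T : L.Theory} {N : Type w} [L.Structure N] {m n : ℕ}
  {A : Set N} {q r : GlobalType L N n} {φ : L.Formula (Fin m ⊕ Fin n)} {κ : Cardinal.{w}}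

/-- The conjunction of the formulas `φ(x; y i)`, for disjoint tuples of variables `y i`. -/
noncomputable def conj (φ : L.Formula (Fin m ⊕ Fin n)) (ι : Type*) [Finite ι] :
    L.Formula (Fin m ⊕ ι × Fin n) :=
  Formula.iInf fun i : ι => φ.relabel (Sum.map id fun t => (i, t))

theorem realize_conj {ι : Type*} [Finite ι] {x : Fin m → N} {c : ι → Fin n → N} :
    (conj φ ι).Realize (Sum.elim x (Function.uncurry c)) ↔
      ∀ i, φ.Realize (Sum.elim x (c i)) := by
  simp only [conj, Formula.realize_iInf, realize_relabel_map_id]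
  rfl

theorem exists_consistentAlong_append (hφr : ∀ i, ConsistentAlong A φ (List.replicate i r))
    (hφq : ∃ l, ¬ ConsistentAlong A φ (List.replicate l q)) :
    ∃ l k, (∀ i, ConsistentAlong A φ (List.replicate l q ++ List.replicate i r)) ∧
      ¬ ConsistentAlong A φ (List.replicate (l + 1) q ++ List.replicate k r) := by
  by_contra! h
  have hall (l : ℕ) : ∀ i, ConsistentAlong A φ (List.replicate l q ++ List.replicate i r) := by
    induction l with
    | zero => simpa using hφr
    | succ l ih => exact fun k => h l k ih
  obtain ⟨l, hl⟩ := hφq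
  exact hl (by simpa using hall l 0)

/-- Each node of the tree carries its block and a Morley list in `q` over the whole tree. The length
of this list is maximal with `φ` consistent along it and any Morley list in `r`. -/
theorem sop1_of_qDivides [Nonempty N] [N ⊨ T] (hN : IsSaturated L κ N)
    (hκ : Cardinal.aleph0 < κ) (hA : Cardinal.mk A < κ) (hq : q.IsInvariant A)
    (hr : r.IsInvariant A) {c : Fin n → N} (hcq : q.IsRealizedOver A c)
    (hcr : r.IsRealizedOver A c) (hφq : QDivides φ q A) (hφr : ¬ QDivides φ r A) : SOP1 T := by
  rw [qDivides_iff_exists_not_consistentAlong hN hκ hA hr] at hφr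
  obtain ⟨l, k, hl, hk⟩ := exists_consistentAlong_append (not_exists_not.1 hφr)
    ((qDivides_iff_exists_not_consistentAlong hN hκ hA hq).1 hφq)
  have hqr (i j : ℕ) : ∀ p ∈ List.replicate i q ++ List.replicate j r, p.IsInvariant A := by
    intro p hp
    rcases List.mem_append.1 hp with hp | hp <;> exact List.eq_of_mem_replicate hp ▸ ‹_›
  choose a ha using exists_isBlockTree hN hκ hA hq hr hcq hcr k
  choose f hf using fun h => exists_isMorleyList_ofFn hN hκ
    (mk_union_range_lt hκ hA (treeEntry (a h))) q l
  have append {h : ℕ} {ps : List (GlobalType L N n)} {s : List (Fin n → N)}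
      (hs : IsMorleyList A ps s) (hsa : ∀ c ∈ s, ∃ ν i, a h ν i = c) :
      IsMorleyList A (List.replicate l q ++ ps) (List.ofFn (f h) ++ s) :=
    hs.append ((hf h).mono
      (Set.union_subset_union_right A (entries_subset_range_treeEntry hsa)))
  refine sop1_of_finite_trees (P := N) (φ := conj φ (Fin (k + 1) ⊕ Fin l))
    (a := fun h ν => Function.uncurry (Sum.elim (a h ν) (f h))) (fun η => ?_)
    (fun h η ν hην hν => ?_)
  · obtain ⟨i, hi⟩ := (ha η.length).path η rfl
    obtain ⟨x, hx⟩ := (hl i).exists_realize (hqr l i) (append hi fun c hc =>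
      (mem_pathList.1 hc).imp fun _ => And.right)
    refine ⟨x, fun ν hν => realize_conj.2 (Sum.forall.2 ⟨fun j => ?_, fun j => ?_⟩)⟩
    · exact hx _ (List.mem_append_right _ (mem_pathList.2 ⟨ν, hν, j, rfl⟩))
    · exact hx _ (List.mem_append_left _ (List.mem_ofFn.2 ⟨j, rfl⟩))
  · rintro ⟨x, hx, hx'⟩
    rw [realize_conj, Sum.forall] at hx hx'
    have hsplit := append (h := h) ((ha h).split η ν hην hν) (by simp [List.mem_ofFn])
    have hcons : ConsistentAlong A φ
        (List.replicate l q ++ q :: List.replicate (k + 1) r) := by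
      refine ⟨_, hsplit, x, ?_⟩
      simp only [List.mem_append, List.mem_cons, List.mem_ofFn]
      rintro _ (⟨i, rfl⟩ | rfl | ⟨i, rfl⟩)
      exacts [hx.2 i, hx'.1 0, hx.1 i]
    refine hk (hcons.sublist ?_)
    rw [List.replicate_succ', List.append_assoc, List.singleton_append]
    exact ((List.replicate_sublist_replicate r).2 k.le_succ).cons_cons q |>.append_left _

theorem kimLemma_of_nsop1 [Nonempty N] [N ⊨ T] (hT : NSOP1 T) (hN : IsSaturated L κ N)
    (hκ : Cardinal.aleph0 < κ) (hA : Cardinal.mk A < κ) : KimLemma L A := by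
  rintro m n φ b ⟨q, hq, hbq, hφq⟩ r hr hbr
  by_contra hφr
  exact hT (sop1_of_qDivides hN hκ hA hq hr (GlobalType.isRealizedOver_iff_tp_subset.2 hbq)
    (GlobalType.isRealizedOver_iff_tp_subset.2 hbr) hφq hφr)

end KimLemma

section SplitArray

theorem append_replicate_prefix {X : Type*} (l : List X) (x : X) {i j : ℕ} (h : i ≤ j) :
    l ++ List.replicate i x <+: l ++ List.replicate j x := by
  rw [List.prefix_append_right_inj, ← Nat.add_sub_cancel' h, ← List.replicate_append_replicate]
  exact List.prefix_append _ _

/-- Two of the nodes `μ ⌢ 0^i ⌢ 1` have the same colour. -/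
theorem exists_split_nodes {K : Type*} [Finite K] (μ : List Bool) (col : List Bool → K) :
    ∃ (x : Bool → List Bool) (η : List Bool), μ <+: η ∧ x true = η ++ [true] ∧
      (η ++ [false]) <+: x false ∧ col (x false) = col (x true) := by
  obtain ⟨i, -, j, -, hij, hcol⟩ := Set.infinite_univ.exists_lt_map_eq_of_mapsTo
    (Set.mapsTo_univ (fun i => col (μ ++ List.replicate i false ++ [true])) _) Set.finite_univ
  refine ⟨fun e => μ ++ List.replicate (bif e then i else j) false ++ [true], _,
    List.prefix_append _ _, rfl, ?_, hcol.symm⟩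
  rw [List.append_assoc, ← List.replicate_succ']
  exact (append_replicate_prefix μ false hij).trans (List.prefix_append _ _)

theorem exists_split_array {K : Type*} [Finite K]
    (col : List (Bool → List Bool) → List Bool → K) : ∃ ν : ℕ → Bool → List Bool,
      (∀ i, col ((List.range i).map ν) (ν i false) = col ((List.range i).map ν) (ν i true)) ∧
      (∀ i j, i ≤ j → ν i false <+: ν j false) ∧
      ∀ i j, i < j → ∃ η, ν i true = η ++ [true] ∧ (η ++ [false]) <+: ν j true := by
  obtain ⟨ν, hν⟩ := exists_seq_of_forall_list fun l : List (Bool → List Bool) =>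
    exists_split_nodes (l.getLast?.elim [] (· false)) (col l)
  choose η hη htrue hfalse hcol using hν
  have hstep (i : ℕ) : ν i false <+: η (i + 1) := by
    simpa [List.range_succ] using hη (i + 1)
  have hmono (i j : ℕ) (hij : i ≤ j) : ν i false <+: ν j false := by
    induction j, hij using Nat.le_induction with
    | base => exact List.prefix_rfl
    | succ j _ ih =>
      exact ih.trans ((hstep j).trans ((List.prefix_append _ _).trans (hfalse (j + 1))))
  refine ⟨ν, hcol, hmono, fun i j hij => ⟨η i, htrue i, ?_⟩⟩
  obtain ⟨j, rfl⟩ := Nat.exists_eq_add_one_of_ne_zero (Nat.ne_zero_of_lt hij)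
  rw [htrue (j + 1)]
  exact (hfalse i).trans ((hmono i j (Nat.lt_succ_iff.1 hij)).trans
    ((hstep j).trans (List.prefix_append _ _)))

end SplitArray

section SkolemHull

variable {L : FirstOrder.Language.{u, v}} {N : Type z} [L.Structure N]

theorem snoc_ultrapowerTuple {I : Type*} (U : Ultrafilter I) {k : ℕ} (x : I → Fin k → N)
    (a : I → N) :
    (Fin.snoc (ultrapowerTuple U x) (a : (U : Filter I).Product fun _ => N) :
      Fin (k + 1) → (U : Filter I).Product fun _ => N) =
      ultrapowerTuple U fun i => (Fin.snoc (x i) (a i) : Fin (k + 1) → N) := by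
  ext t
  induction t using Fin.lastCases with
  | last =>
    simp only [ultrapowerTuple, Fin.snoc_last]
    exact Fin.snoc_last (α := fun _ => (U : Filter I).Product fun _ => N) _ _
  | cast t =>
    simp only [ultrapowerTuple, Fin.snoc_castSucc]
    exact Fin.snoc_castSucc (α := fun _ => (U : Filter I).Product fun _ => N) _ _ _

theorem realize_term_congr {V : Type*} [DecidableEq V] (t : L.Term V) {x y : V → N}
    (h : ∀ p ∈ t.varFinset, x p = y p) : t.realize x = t.realize y := by
  rw [← Term.realize_restrictVar (f := Subtype.val) y fun _ => rfl]
  exact (Term.realize_restrictVar x fun p => (h p p.2).symm).symm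

theorem mk_term_sum_skolem₁_le {V : Type} [Countable V] :
    Cardinal.mk ((L.sum L.skolem₁).Term V) ≤ max Cardinal.aleph0 L.card := by
  refine Term.card_le.trans (max_le (le_max_left _ _) ?_)
  rw [Cardinal.mk_sum, Cardinal.lift_uzero]
  exact Cardinal.add_le_of_le (le_max_left _ _)
    ((Cardinal.lift_le_aleph0.2 Cardinal.mk_le_aleph0).trans (le_max_left _ _))
    card_functions_sum_skolem₁_le

variable [Nonempty N] {I V : Type*} (U : Ultrafilter I)

theorem realize_boundedFormula_ultrapowerTuple {k : ℕ} {ψ : L.BoundedFormula Empty k}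
    {x : I → Fin k → N} :
    ψ.Realize default (ultrapowerTuple U x) ↔
      ∀ᶠ i in (U : Filter I), ψ.Realize default (x i) := by
  have h := realize_ultrapowerTuple U (θ := ψ.toFormula) (x := fun i => Sum.elim default (x i))
  simp only [BoundedFormula.realize_toFormula, Sum.elim_comp_inl, Sum.elim_comp_inr] at h
  rwa [Subsingleton.elim (ultrapowerTuple U _ ∘ Sum.inl) default] at h

/-- Skolem functions of the factors act coordinatewise, so by Łoś' theorem they yield witnesses in
the ultrapower. -/
theorem exists_elementarySubstructure_ultrapower (v : I → V → N) :
    ∃ S : L.ElementarySubstructure ((U : Filter I).Product fun _ => N), (S : Set _) =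
      Set.range (ultrapowerTuple U fun i (t : (L.sum L.skolem₁).Term V) => t.realize (v i)) := by
  let e := ultrapowerTuple U fun i (t : (L.sum L.skolem₁).Term V) => t.realize (v i)
  let S : L.Substructure ((U : Filter I).Product fun _ => N) :=
    { carrier := Set.range e
      fun_mem := by
        intro k f x hx
        choose t ht using hx
        obtain rfl : e ∘ t = x := funext ht
        exact ⟨Term.func (LHom.sumInl.onFunction f) t, (Ultraproduct.funMap_cast f _).symm⟩ }
  refine ⟨S.toElementarySubstructure fun k ψ x a ha => ?_, rfl⟩
  choose t ht using fun j => (x j).2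
  obtain hx : ((↑) ∘ x) = e ∘ t := funext fun j => (ht j).symm
  obtain ⟨a, rfl⟩ := Quotient.exists_rep a
  refine ⟨⟨_, Term.func (LHom.sumInr.onFunction ψ) t, rfl⟩, ?_⟩
  rw [hx] at ha ⊢
  have hsnoc := snoc_ultrapowerTuple U fun i j => (t j).realize (v i)
  replace ha := (realize_boundedFormula_ultrapowerTuple U).1 ((congrArg _ (hsnoc a)).mp ha)
  refine (congrArg _ (hsnoc _)).mpr ((realize_boundedFormula_ultrapowerTuple U).2 (ha.mono ?_))
  exact fun i hi => Classical.epsilon_spec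
    (p := fun b => ψ.Realize default (Fin.snoc (fun j => (t j).realize (v i)) b)) ⟨a i, hi⟩

end SkolemHull

section SOP1Array

variable {L : FirstOrder.Language.{u, v}} {m n : ℕ} {φ : L.Formula (Fin m ⊕ Fin n)}

/-- The rows of the array `c` have the same limit type over the whole structure in both columns.
The formula `φ(x; y)` is consistent along the left column, and its instances along the right column
are pairwise inconsistent. Arrays of this form arise from SOP₁ trees. -/
structure IsSOP1Array {M : Type*} [L.Structure M] (φ : L.Formula (Fin m ⊕ Fin n))
    (c : ℕ → Bool → Fin n → M) : Prop where
  eventually_iff : ∀ (k : ℕ) (θ : L.Formula (Fin n ⊕ Fin k)) (x : Fin k → M),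
    ∀ᶠ i in Filter.atTop,
      θ.Realize (Sum.elim (c i false) x) ↔ θ.Realize (Sum.elim (c i true) x)
  consistent : Consistent φ fun i => c i false
  inconsistent : ∀ i j, i < j → ¬ Consistent φ ![c i true, c j true]

theorem IsSOP1Tree.exists_realize {N : Type*} [L.Structure N] {a : List Bool → Fin n → N}
    (h : IsSOP1Tree φ a) (μ : List Bool) : ∃ x, ∀ ν, ν <+: μ → φ.Realize (Sum.elim x (a ν)) := by
  obtain ⟨x, hx⟩ := h.1 (fun i => μ.getD i false) (Finset.range (μ.length + 1))
  refine ⟨x, ?_⟩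
  rintro ν ⟨τ, rfl⟩
  have hν : (List.range ν.length).map (fun i => (ν ++ τ).getD i false) = ν :=
    List.ext_getElem (by simp) fun i _ hi => by simp [List.getElem?_append_left hi, hi]
  simpa only [hν] using hx ν.length (by simp)

/-- The formulas `θ(y; t)` whose parameters are Skolem terms in the entries of an array. -/
abbrev SkolemFormula (L : FirstOrder.Language.{u, v}) (n : ℕ) : Type (max u v) :=
  Σ k, L.Formula (Fin n ⊕ Fin k) × (Fin k → (L.sum L.skolem₁).Term (ℕ × Bool × Fin n))

/-- The entries of an array of tuples, as a single family. -/
def arrayEntry {X : Type*} (c : ℕ → Bool → Fin n → X) (p : ℕ × Bool × Fin n) : X :=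
  c p.1 p.2.1 p.2.2

/-- Both columns of the array `c` agree on the formula in each row below all rows that occur in its
parameters. -/
def SkolemFormula.Agrees {N : Type*} [L.Structure N] [Nonempty N] (δ : SkolemFormula L n)
    (c : ℕ → Bool → Fin n → N) : Prop :=
  ∀ i, (∀ j, ∀ p ∈ (δ.2.2 j).varFinset, p.1 < i) →
    (δ.2.1.Realize (Sum.elim (c i false) fun j => (δ.2.2 j).realize (arrayEntry c)) ↔
      δ.2.1.Realize (Sum.elim (c i true) fun j => (δ.2.2 j).realize (arrayEntry c)))

theorem IsSOP1Tree.exists_array {N : Type*} [L.Structure N] [Nonempty N]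
    {a : List Bool → Fin n → N} (h : IsSOP1Tree φ a) (Δ : Finset (SkolemFormula L n)) :
    ∃ c : ℕ → Bool → Fin n → N, (∀ δ ∈ Δ, δ.Agrees c) ∧ (Consistent φ fun i => c i false) ∧
      ∀ i j, i < j → ¬ Consistent φ ![c i true, c j true] := by
  -- Rows that have not been constructed yet are filled with the root.
  let rowEntry (l : List (Bool → List Bool)) : ℕ × Bool × Fin n → N :=
    arrayEntry fun i e => a (l.getD i (fun _ => []) e)
  obtain ⟨ν, hcol, hleft, hright⟩ := exists_split_array fun l μ (δ : Δ) =>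
    δ.1.2.1.Realize (Sum.elim (a μ) fun j => (δ.1.2.2 j).realize (rowEntry l))
  refine ⟨fun i e => a (ν i e), fun δ hδ i hi => ?_, fun F => ?_, fun i j hij => ?_⟩
  · have ht (j) : (δ.2.2 j).realize (rowEntry ((List.range i).map ν)) =
        (δ.2.2 j).realize (arrayEntry fun i e => a (ν i e)) :=
      realize_term_congr _ fun p hp => by simp [rowEntry, arrayEntry, hi j p hp]
    simpa only [ht] using iff_of_eq (congrFun (hcol i) ⟨δ, hδ⟩)
  · obtain ⟨x, hx⟩ := h.exists_realize (ν (F.sup id) false)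
    exact ⟨x, fun i hi => hx _ (hleft i _ (Finset.le_sup (f := id) hi))⟩
  · obtain ⟨η, hη, hsplit⟩ := hright i j hij
    simpa only [hη, and_comm, consistent_pair_iff] using h.2 η _ hsplit

section Ultrapower

variable {N I : Type*} [L.Structure N] [Nonempty N] {U : Ultrafilter I}

theorem consistent_ultrapowerTuple {ι : Type*} {b : I → ι → Fin n → N}
    (h : ∀ i, Consistent φ (b i)) : Consistent φ fun t => ultrapowerTuple U fun i => b i t := by
  intro s
  choose x hx using fun i => h i s
  refine ⟨ultrapowerTuple U x, fun t ht => ?_⟩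
  rw [elim_ultrapowerTuple, realize_ultrapowerTuple]
  exact .of_forall fun i => hx i t ht

theorem exists_consistent_of_ultrapowerTuple {b c : I → Fin n → N}
    (h : Consistent φ ![ultrapowerTuple U b, ultrapowerTuple U c]) :
    ∃ i, Consistent φ ![b i, c i] := by
  obtain ⟨x, hxb, hxc⟩ := consistent_pair_iff.1 h
  obtain ⟨x, rfl⟩ := exists_ultrapowerTuple_eq U x
  rw [elim_ultrapowerTuple, realize_ultrapowerTuple] at hxb hxc
  obtain ⟨i, hb, hc⟩ := (hxb.and hxc).exists
  exact ⟨i, consistent_pair_iff.2 ⟨_, hb, hc⟩⟩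

theorem eventually_agrees {U : Ultrafilter (Finset (SkolemFormula L n))}
    (hU : (U : Filter (Finset (SkolemFormula L n))) ≤ Filter.atTop)
    {c : Finset (SkolemFormula L n) → ℕ → Bool → Fin n → N}
    (hc : ∀ Δ, ∀ δ : SkolemFormula L n, δ ∈ Δ → δ.Agrees (c Δ))
    (k : ℕ) (θ : L.Formula (Fin n ⊕ Fin k))
    (t : Fin k → (L.sum L.skolem₁).Term (ℕ × Bool × Fin n)) :
    ∀ᶠ i in Filter.atTop,
      (∀ᶠ Δ in (U : Filter (Finset (SkolemFormula L n))),
        θ.Realize (Sum.elim (c Δ i false) fun j => (t j).realize (arrayEntry (c Δ)))) ↔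
      ∀ᶠ Δ in (U : Filter (Finset (SkolemFormula L n))),
        θ.Realize (Sum.elim (c Δ i true) fun j => (t j).realize (arrayEntry (c Δ))) := by
  have hvar : ∀ᶠ i in Filter.atTop, ∀ j, ∀ p ∈ (t j).varFinset, p.1 < i := by
    simp only [Filter.eventually_all, Filter.eventually_all_finset]
    exact fun j p _ => Filter.eventually_gt_atTop p.1
  filter_upwards [hvar] with i hi
  refine Filter.eventually_congr ?_
  filter_upwards [hU (Filter.eventually_ge_atTop {⟨k, θ, t⟩})] with Δ hΔ
  exact hc Δ _ (hΔ (Finset.mem_singleton_self _)) i hi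

end Ultrapower

/-- The array lies in the Skolem hull of an ultraproduct of arrays with more and more formulas
agreeing on both columns. -/
theorem SOP1.exists_isSOP1Array {T : L.Theory} (h : SOP1 T) :
    ∃ (M : Theory.ModelType.{u, v, max u v} T) (m n : ℕ) (φ : L.Formula (Fin m ⊕ Fin n))
      (c : ℕ → Bool → Fin n → M),
      IsSOP1Array φ c ∧ Cardinal.mk M ≤ max Cardinal.aleph0 L.card := by
  obtain ⟨N, m, n, φ, a, ha⟩ := h
  choose c hc hleft hright using IsSOP1Tree.exists_array ha
  let U : Ultrafilter (Finset (SkolemFormula L n)) := Ultrafilter.of Filter.atTop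
  obtain ⟨S, hS⟩ := exists_elementarySubstructure_ultrapower (L := L) U fun Δ => arrayEntry (c Δ)
  have := ultrapower_models (P := N) U T
  have hmem (i e t) : ultrapowerTuple U (fun Δ => c Δ i e) t ∈ S := by
    rw [← SetLike.mem_coe, hS]
    exact ⟨Term.var (i, e, t), rfl⟩
  have harray : IsSOP1Array φ fun i e t => (⟨_, hmem i e t⟩ : S) := by
    refine ⟨fun k θ x => ?_, ?_, fun i j hij hcons => ?_⟩
    · choose t ht using fun j => (Set.ext_iff.1 hS _).1 (x j).2
      have realize_iff (i : ℕ) (e : Bool) :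
          θ.Realize (Sum.elim (fun s => (⟨_, hmem i e s⟩ : S)) x) ↔ ∀ᶠ Δ in (U : Filter _),
            θ.Realize (Sum.elim (c Δ i e) fun j => (t j).realize (arrayEntry (c Δ))) := by
        rw [← realize_ultrapowerTuple, ← elim_ultrapowerTuple, ← S.subtype.map_formula,
          Sum.comp_elim]
        exact iff_of_eq (congrArg (fun y => θ.Realize (Sum.elim _ y)) (funext fun j => (ht j).symm))
      simpa only [realize_iff] using eventually_agrees (Ultrafilter.of_le _) hc k θ t
    · exact (consistent_comp_iff S.subtype).1 (consistent_ultrapowerTuple hleft)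
    · obtain ⟨Δ, hΔ⟩ := exists_consistent_of_ultrapowerTuple
        ((consistent_comp_pair_iff S.subtype).2 hcons)
      exact hright Δ i j hij hΔ
  refine ⟨.of T S, m, n, φ, _, harray, (Cardinal.mk_congr (Equiv.setCongr hS)).trans_le ?_⟩
  exact Cardinal.mk_range_le.trans mk_term_sum_skolem₁_le

end SOP1Array

section HigherFormulas

variable {L : FirstOrder.Language.{u, v}} {N : Type w} [L.Structure N] {m n : ℕ} {A : Set N}
  {φ : L.Formula (Fin m ⊕ Fin n)} {D : Ultrafilter (tuples n A)} {b : ℕ → Fin n → N}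

theorem IsMorleySequence.realize_of_eventually
    (hb : IsMorleySequence (average (L := L) D Set.univ) A b) {ι : Type*} [Finite ι]
    {θ : L.Formula (Fin n ⊕ ι)} {x : ι → N} {i : ℕ} (hx : ∀ j, x j ∈ below A b i)
    (hθ : ∀ᶠ c : tuples n A in (D : Filter _), θ.Realize (Sum.elim c.1 x)) :
    θ.Realize (Sum.elim (b i) x) := by
  let e := Finite.equivFin ι
  have realize_iff (c : Fin n → N) : (inst (θ.relabel (Sum.map id e)) (x ∘ e.symm)).Realize c ↔
      θ.Realize (Sum.elim c x) := by
    rw [realize_inst, realize_relabel_map_id, Function.comp_assoc, Equiv.symm_comp_self,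
      Function.comp_id]
  exact (realize_iff _).1 (hb i _ ⟨⟨⟨_, _, _, fun _ => Set.mem_univ _, rfl⟩,
    hθ.mono fun c => (realize_iff c).2⟩, _, _, _, fun j => hx _, rfl⟩)

theorem IsMorleySequence.realize_iff_eventually
    (hb : IsMorleySequence (average (L := L) D Set.univ) A b) {ι : Type*} [Finite ι]
    {θ : L.Formula (Fin n ⊕ ι)} {x : ι → N} {i : ℕ} (hx : ∀ j, x j ∈ below A b i) :
    θ.Realize (Sum.elim (b i) x) ↔
      ∀ᶠ c : tuples n A in (D : Filter _), θ.Realize (Sum.elim c.1 x) := by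
  refine ⟨fun h => ?_, hb.realize_of_eventually hx⟩
  by_contra hθ
  refine Formula.realize_not.1 (hb.realize_of_eventually (θ := θ.not) hx ?_) h
  simpa only [Formula.realize_not] using Ultrafilter.eventually_not.2 hθ

theorem IsMorleySequence.exists_realize_cons_iff
    (hb : IsMorleySequence (average (L := L) D Set.univ) A b) {i : ℕ} {l : List (Fin n → N)}
    (hl : entries l ⊆ below A b i) :
    (∃ x, ∀ d ∈ b i :: l, φ.Realize (Sum.elim x d)) ↔
      ∀ᶠ c : tuples n A in (D : Filter _), ∃ x, ∀ d ∈ c.1 :: l, φ.Realize (Sum.elim x d) := by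
  let y : Fin l.length → Fin n → N := l.get
  let θ : L.Formula (Fin n ⊕ Fin l.length × Fin n) := Formula.iExs (Fin m)
    (φ.relabel (Sum.elim Sum.inr (Sum.inl ∘ Sum.inl)) ⊓
      (conj φ (Fin l.length)).relabel (Sum.elim Sum.inr (Sum.inl ∘ Sum.inr)))
  have realize_iff (c : Fin n → N) : θ.Realize (Sum.elim c (Function.uncurry y)) ↔
      ∃ x, ∀ d ∈ c :: l, φ.Realize (Sum.elim x d) := by
    simp only [θ, Formula.realize_iExs, Formula.realize_inf, Formula.realize_relabel,
      Sum.comp_elim, ← Function.comp_assoc, Sum.elim_comp_inl, Sum.elim_comp_inr, realize_conj,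
      List.forall_mem_cons, List.forall_mem_iff_get, y]
  simp only [← realize_iff]
  refine hb.realize_iff_eventually fun p => hl ?_
  exact Set.mem_biUnion (l.get_mem p.1) (Set.mem_range_self p.2)

theorem entries_subset_below {l : List (Fin n → N)} {i : ℕ}
    (hl : ∀ c ∈ l, c ∈ tuples n A ∨ ∃ j < i, b j = c) : entries l ⊆ below A b i := by
  refine Set.iUnion₂_subset fun c hc => Set.range_subset_iff.2 fun t => ?_
  rcases hl c hc with hc | ⟨j, hj, rfl⟩
  exacts [.inl (hc t), .inr ⟨j, hj, t, rfl⟩]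

theorem isHigher_of_consistent {ι : Type*} {d : ι → tuples n A}
    (hd : Consistent φ fun i => (d i).1)
    (hD : ∀ᶠ c : tuples n A in (D : Filter _), c ∈ Set.range d) :
    IsHigher φ A D := by
  classical
  intro b hb
  have exists_realize (k : ℕ) (s : List ι) :
      ∃ x, ∀ c ∈ (List.range k).map b ++ s.map (d · |>.1), φ.Realize (Sum.elim x c) := by
    induction k generalizing s with
    | zero => simpa using hd s.toFinset
    | succ k ih =>
      have hl : entries ((List.range k).map b ++ s.map (d · |>.1)) ⊆ below A b k := by
        refine entries_subset_below fun c hc => ?_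
        rcases List.mem_append.1 hc with hc | hc
        · exact .inr (by simpa using hc)
        · obtain ⟨j, -, rfl⟩ := List.mem_map.1 hc
          exact .inl (d j).2
      have hD' : ∀ᶠ c : tuples n A in (D : Filter _), ∃ x,
          ∀ e ∈ c.1 :: ((List.range k).map b ++ s.map (d · |>.1)), φ.Realize (Sum.elim x e) := by
        filter_upwards [hD]
        rintro _ ⟨j, rfl⟩
        obtain ⟨x, hx⟩ := ih (j :: s)
        exact ⟨x, fun e he => hx e (List.perm_middle.mem_iff.2 he)⟩
      obtain ⟨x, hx⟩ := (hb.exists_realize_cons_iff hl).2 hD'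
      refine ⟨x, fun e he => hx e ?_⟩
      rw [List.range_succ, List.map_append, List.append_assoc] at he
      exact List.perm_middle.mem_iff.1 he
  intro F
  obtain ⟨x, hx⟩ := exists_realize (F.sup id + 1) []
  exact ⟨x, fun i hi => hx _ (by simpa using ⟨i, Finset.le_sup (f := id) hi, rfl⟩)⟩

theorem not_isHigher_of_not_consistent [Nonempty N] {κ : Cardinal.{w}} (hN : IsSaturated L κ N)
    (hκ : Cardinal.aleph0 < κ) (hA : Cardinal.mk A < κ)
    (hD : ∀ᶠ c : tuples n A in (D : Filter _), ∀ᶠ d : tuples n A in (D : Filter _),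
      ¬ Consistent φ ![c.1, d.1]) :
    ¬ IsHigher φ A D := by
  intro h
  obtain ⟨b, hb⟩ := exists_isMorleySequence hN hκ (averageType L D) hA
  replace hb : IsMorleySequence (average (L := L) D Set.univ) A b := fun i => by
    rw [average_univ_inter_formulasOver]
    exact hb i
  obtain ⟨x, hx⟩ := h b hb {0, 1}
  have h₁ := (hb.exists_realize_cons_iff (φ := φ) (i := 1) (l := [b 0])
    (entries_subset_below (by simp))).1 ⟨x, by simpa [and_comm] using hx⟩
  obtain ⟨c, hc, ⟨y, hy⟩⟩ := (hD.and h₁).exists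
  have h₀ := (hb.exists_realize_cons_iff (φ := φ) (i := 0) (l := [c.1])
    (entries_subset_below (by simp))).1 ⟨y, by simpa [and_comm] using hy⟩
  obtain ⟨d, hd, ⟨z, hz⟩⟩ := (hc.and h₀).exists
  exact hd (consistent_pair_iff.2 ⟨z, by simpa [and_comm] using hz⟩)

end HigherFormulas

section SOP1Model

variable {L : FirstOrder.Language.{u, v}} {N : Type w} [L.Structure N] {M : Type z} [L.Structure M]
  {m n : ℕ} {φ : L.Formula (Fin m ⊕ Fin n)} {c : ℕ → Bool → Fin n → M} {κ : Cardinal.{w}}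

/-- The images of a nonprincipal ultrafilter on `ℕ` under the two columns of the array have the same
average type over the model, but only the left one makes `φ` a higher formula. -/
theorem IsSOP1Array.not_ultrafilterIndependence [Nonempty N] (h : IsSOP1Array φ c) (g : M ↪ₑ[L] N)
    (hN : IsSaturated L κ N) (hκ : Cardinal.aleph0 < κ) (hM : Cardinal.mk (Set.range g) < κ) :
    ¬ UltrafilterIndependence L (Set.range g) := by
  let U : Ultrafilter ℕ := Filter.hyperfilter ℕ
  have hU : (U : Filter ℕ) ≤ Filter.atTop := Nat.hyperfilter_le_atTop
  let row (e : Bool) (i : ℕ) : tuples n (Set.range g) := ⟨g ∘ c i e, fun t => ⟨c i e t, rfl⟩⟩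
  have average_eq : average (L := L) (U.map (row false)) (Set.range g) =
      average (L := L) (U.map (row true)) (Set.range g) := by
    ext ψ
    refine and_congr_right ?_
    rintro ⟨k, θ, a, ha, rfl⟩
    choose x hx using ha
    obtain rfl : g ∘ x = a := funext hx
    have realize_row (e : Bool) (i : ℕ) : (inst θ (g ∘ x)).Realize (row e i).1 ↔
        θ.Realize (Sum.elim (c i e) x) := by
      rw [realize_inst, ← Sum.comp_elim, g.map_formula]
    exact Filter.eventually_congr (((h.eventually_iff k θ x).filter_mono hU).mono fun i hi =>
      (realize_row false i).trans (hi.trans (realize_row true i).symm))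
  have isHigher_left : IsHigher φ (Set.range g) (U.map (row false)) :=
    isHigher_of_consistent (d := row false) ((consistent_comp_iff g).2 h.consistent)
      (Filter.eventually_map.2 (.of_forall Set.mem_range_self))
  have not_isHigher_right : ¬ IsHigher φ (Set.range g) (U.map (row true)) := by
    refine not_isHigher_of_not_consistent hN hκ hM (Filter.eventually_map.2 (.of_forall fun i =>
      Filter.eventually_map.2 ?_))
    filter_upwards [hU (Filter.eventually_gt_atTop i)] with j hij
    exact (consistent_comp_pair_iff g).not.2 (h.inconsistent i j hij)
  exact fun hind => not_isHigher_right ((hind m n φ _ _ average_eq).1 isHigher_left)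

theorem exists_elementarySubstructure_eq_range (g : M ↪ₑ[L] N) :
    ∃ S : L.ElementarySubstructure N, (S : Set N) = Set.range g := by
  refine ⟨⟨g.toEmbedding.toHom.range, fun k ψ x => ?_⟩, rfl⟩
  obtain ⟨y, rfl⟩ : ∃ y : Fin k → M, g.toEmbedding.equivRange ∘ y = x :=
    ⟨g.toEmbedding.equivRange.symm ∘ x, funext fun i => Equiv.apply_symm_apply _ _⟩
  exact (g.map_formula ψ y).trans
    (g.toEmbedding.equivRange.toElementaryEmbedding.map_formula ψ y).symm

theorem exists_not_ultrafilterIndependence_of_sop1 {T : L.Theory} (hT : T.IsComplete) (h : SOP1 T)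
    [Nonempty N] [N ⊨ T] (hN : IsSaturated L κ N) (hκ : Cardinal.aleph0 < κ)
    (hL : Cardinal.lift.{w} L.card < Cardinal.lift.{max u v} κ) :
    ∃ S : L.ElementarySubstructure N, Cardinal.mk S < κ ∧
      ¬ UltrafilterIndependence L (S : Set N) := by
  obtain ⟨M, m, n, φ, c, hc, hM⟩ := h.exists_isSOP1Array
  have hMκ : Cardinal.lift.{w} (Cardinal.mk M) < Cardinal.lift.{max u v} κ := by
    refine (Cardinal.lift_le.2 hM).trans_lt ?_
    rw [Cardinal.lift_max, Cardinal.lift_aleph0]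
    exact max_lt (Cardinal.aleph0_lt_lift.2 hκ) hL
  obtain ⟨g⟩ := hN.exists_elementaryEmbedding hκ (hT.models_elementarily_equivalent M N) hMκ
  obtain ⟨S, hS⟩ := exists_elementarySubstructure_eq_range g
  have hg : Cardinal.mk (Set.range g) < κ :=
    Cardinal.lift_lt.1 (Cardinal.mk_range_le_lift.trans_lt hMκ)
  exact ⟨S, (Cardinal.mk_congr (Equiv.setCongr hS)).trans_lt hg,
    hS ▸ hc.not_ultrafilterIndependence g hN hκ hg⟩

end SOP1Model

end KimDividing

open KimDividing in
theorem theorem3p16_general {L : FirstOrder.Language.{u, v}} (T : L.Theory) (hT : T.IsComplete)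
    (κ : Cardinal.{w}) (hκ : Cardinal.aleph0 < κ)
    (hL : Cardinal.lift.{w} L.card < Cardinal.lift.{max u v} κ)
    (𝕄 : Type w) [L.Structure 𝕄] [Nonempty 𝕄] [T.Model 𝕄] (h𝕄 : IsSaturated L κ 𝕄) :
    [ NSOP1 T,
      ∀ M : L.ElementarySubstructure 𝕄, Cardinal.mk M < κ →
        UltrafilterIndependence L (M : Set 𝕄),
      ∀ M : L.ElementarySubstructure 𝕄, Cardinal.mk M < κ → KimLemma L (M : Set 𝕄),
      ∀ A : Set 𝕄, Cardinal.mk A < κ → UltrafilterIndependence L A,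
      ∀ A : Set 𝕄, Cardinal.mk A < κ → KimLemma L A ].TFAE := by
  tfae_have 1 → 5 := fun hNSOP1 A hA => kimLemma_of_nsop1 hNSOP1 h𝕄 hκ hA
  tfae_have 5 → 4 := fun h A hA => (h A hA).ultrafilterIndependence h𝕄 hA
  tfae_have 5 → 3 := fun h M hM => h M hM
  tfae_have 3 → 2 := fun h M hM => (h M hM).ultrafilterIndependence h𝕄 hM
  tfae_have 4 → 2 := fun h M hM => h M hM
  tfae_have 2 → 1 := by
    intro h hSOP1
    obtain ⟨M, hM, hM'⟩ := exists_not_ultrafilterIndependence_of_sop1 hT hSOP1 h𝕄 hκ hL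
    exact hM' (h M hM)
  tfae_finish

theorem theorem3p16 {L : FirstOrder.Language.{u, v}} (T : L.Theory) (hT : T.IsComplete)
    -- the monster model: `κ`-saturated; "small" means of cardinality less than `κ`
    (κ : Cardinal.{w}) (hκ : Cardinal.aleph0 < κ)
    (hL : Cardinal.lift.{w} L.card < Cardinal.lift.{max u v} κ)
    (𝕄 : Type w) [L.Structure 𝕄] [Nonempty 𝕄] [T.Model 𝕄]
    (h𝕄 : KimDividing.IsSaturated L κ 𝕄) :
    [ KimDividing.NSOP1 T,
      ∀ M : L.ElementarySubstructure 𝕄, Cardinal.mk M < κ →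
        ∀ (m n : ℕ) (φ : L.Formula (Fin m ⊕ Fin n))
          (D E : Ultrafilter (KimDividing.tuples n (M : Set 𝕄))),
          KimDividing.average (L := L) D (M : Set 𝕄) =
            KimDividing.average (L := L) E (M : Set 𝕄) →
          (KimDividing.IsHigher φ (M : Set 𝕄) D ↔ KimDividing.IsHigher φ (M : Set 𝕄) E),
      ∀ M : L.ElementarySubstructure 𝕄, Cardinal.mk M < κ →
        ∀ (m n : ℕ) (φ : L.Formula (Fin m ⊕ Fin n)) (b : Fin n → 𝕄),
          (∃ q : KimDividing.GlobalType L 𝕄 n, q.IsInvariant (M : Set 𝕄) ∧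
            KimDividing.tp L b (M : Set 𝕄) ⊆ q.formulas ∧
            KimDividing.QDivides φ q (M : Set 𝕄)) →
          ∀ q : KimDividing.GlobalType L 𝕄 n, q.IsInvariant (M : Set 𝕄) →
            KimDividing.tp L b (M : Set 𝕄) ⊆ q.formulas →
            KimDividing.QDivides φ q (M : Set 𝕄) ].TFAE :=
  fun P hP Q hQ => theorem3p16_general T hT κ hκ hL 𝕄 h𝕄
    P (List.mem_of_mem_take (i := 3) hP) Q (List.mem_of_mem_take (i := 3) hQ)
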